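/- Let $N=p_1\cdots p_r$ be a square-free positive integer with $r\ge 0$ distinct prime factors, and let $$\Gamma_0(N)^+=\left\{ e^{-1/2}\begin{pmatrix} a&b\\c&d\end{pmatrix}\in \mathrm{SL}(2,\mathbb R):\ ad-bc=e,\ a,b,c,d,e\in\mathbb Z,\ e\mid N,\ e\mid a,\ e\mid d,\ N\mid c\right\}.$$ Let $\Gamma_\infty(N)$ be the stabilizer of the cusp $i\infty$ in $\Gamma_0(N)^+$. For $z\in\mathbb H$ (the upper half plane) and $\mathrm{Re}(s)>1$ put $$\mathcal E_\infty(z,s)=\sum_{\gamma\in\Gamma_\infty(N)\backslash\Gamma_0(N)^+}\mathrm{Im}(\gamma z)^s ,$$ and let $\eta(z)=e^{2\pi i z/24}\prod_{n\ge1}(1-e^{2\pi i nz})$ be Dedekind's eta function. Proposition 5.3. For every $z\in\mathbb H$ the series converges absolutely for $\mathrm{Re}(s)>1$, and $s\mapsto\mathcal E_\infty(z,s)$ has a (unique) meromorphic continuation to $\mathbb C$. This continuation is holomorphic at $s=0$, and its Taylor expansion there is $$\mathcal E_\infty(z,s)=1+\log\left(\Bigl(\prod_{v\mid N}|\eta(vz)|^4\Bigr)^{1/2^r}\cdot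 \mathrm{Im}(z)\right)\cdot s+O(s^2)\qquad\text{as } s\to0,$$ where $v$ runs over the positive divisors of $N$. -/

import Mathlib

open scoped MatrixGroups Topology

/-- The moonshine group `Γ₀(N)⁺` inside `SL(2, ℝ)`: the matrices `e^{-1/2} (a b; c d)` with
`a, b, c, d, e` integers, `ad - bc = e`, `e ∣ N`, `e ∣ a`, `e ∣ d` and `N ∣ c`. (Positivity of `e`
is implicit in `e^{-1/2}` being a real number.) -/
noncomputable def moonshineGroup (N : ℕ) : Subgroup SL(2, ℝ) where
  carrier := {γ | ∃ a b c d e : ℤ, 0 < e ∧ a * d - b * c = e ∧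
    e ∣ (N : ℤ) ∧ e ∣ a ∧ e ∣ d ∧ (N : ℤ) ∣ c ∧
    (γ : Matrix (Fin 2) (Fin 2) ℝ) =
      (1 / Real.sqrt (e : ℝ)) • !![(a : ℝ), (b : ℝ); (c : ℝ), (d : ℝ)]}
  one_mem' := ⟨1, 0, 0, 1, 1, by simp [Matrix.one_fin_two]⟩
  mul_mem' := by
    rintro γ γ' ⟨a, b, c, d, e, he, hdet, heN, hea, hed, hNc, hγ⟩
      ⟨a', b', c', d', f, hf, hdet', hfN, hfa', hfd', hNc', hγ'⟩
    obtain ⟨g, e₁, f₁, hg0, hcop, rfl, rfl⟩ :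
        ∃ g e₁ f₁ : ℤ, 0 < g ∧ IsCoprime e₁ f₁ ∧ e = g * e₁ ∧ f = g * f₁ := by
      have hgpos : 0 < Int.gcd e f := Int.gcd_pos_of_ne_zero_left f he.ne'
      obtain ⟨e₁, f₁, h, h1, h2⟩ := Int.exists_gcd_one hgpos
      exact ⟨Int.gcd e f, e₁, f₁, by exact_mod_cast hgpos, Int.isCoprime_iff_gcd_eq_one.2 h,
        by rw [mul_comm]; exact h1, by rw [mul_comm]; exact h2⟩
    have he₁ : 0 < e₁ := pos_of_mul_pos_right he hg0.le
    have hf₁ : 0 < f₁ := pos_of_mul_pos_right hf hg0.le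
    have hlcmN : g * (e₁ * f₁) ∣ (N : ℤ) := by
      obtain ⟨k, hk⟩ := heN
      obtain ⟨l, hl⟩ := hfN
      have h1 : e₁ * k = f₁ * l := by
        have : g * (e₁ * k) = g * (f₁ * l) := by linarith
        exact mul_left_cancel₀ hg0.ne' this
      have h2 : f₁ ∣ k := hcop.symm.dvd_of_dvd_mul_left ⟨l, h1⟩
      obtain ⟨m, rfl⟩ := h2
      exact ⟨m, by rw [hk]; ring⟩
    obtain ⟨k, hk⟩ := hlcmN
    obtain ⟨α, rfl⟩ := hea
    obtain ⟨δ, rfl⟩ := hed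
    obtain ⟨α', rfl⟩ := hfa'
    obtain ⟨δ', rfl⟩ := hfd'
    obtain ⟨χ, rfl⟩ := hNc
    obtain ⟨χ', rfl⟩ := hNc'
    rw [hk] at hdet hdet' hγ hγ'
    refine ⟨g * (e₁ * f₁) * α * α' + b * (e₁ * f₁ * k) * χ', e₁ * α * b' + b * (f₁ * δ'),
      N * (χ * (f₁ * α') + e₁ * δ * χ'),
      e₁ * f₁ * k * χ * b' + g * (e₁ * f₁) * δ * δ', e₁ * f₁, by positivity, ?_, ?_, ?_, ?_, ?_, ?_⟩
    · rw [hk]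
      have hg2 : g * g ≠ 0 := by positivity
      apply mul_left_cancel₀ hg2
      linear_combination (g * e₁ * α * (g * e₁ * δ) - b * (g * (e₁ * f₁) * k * χ)) * hdet' +
        g * f₁ * hdet
    · exact ⟨g * k, by rw [hk]; ring⟩
    · exact ⟨g * α * α' + b * k * χ', by ring⟩
    · exact ⟨k * χ * b' + g * δ * δ', by ring⟩
    · exact ⟨_, rfl⟩
    · rw [Matrix.SpecialLinearGroup.coe_mul, hγ, hγ', hk]
      have hgR : (0 : ℝ) < g := by exact_mod_cast hg0
      have heR : (0 : ℝ) < e₁ := by exact_mod_cast he₁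
      have hfR : (0 : ℝ) < f₁ := by exact_mod_cast hf₁
      have hs : 1 / Real.sqrt ((g : ℝ) * e₁) * (1 / Real.sqrt ((g : ℝ) * f₁)) * g =
          1 / Real.sqrt ((e₁ : ℝ) * f₁) := by
        rw [Real.sqrt_mul hgR.le, Real.sqrt_mul hgR.le, Real.sqrt_mul heR.le]
        have := Real.mul_self_sqrt hgR.le
        have h1 := (Real.sqrt_pos.2 hgR).ne'
        have h2 := (Real.sqrt_pos.2 heR).ne'
        have h3 := (Real.sqrt_pos.2 hfR).ne'
        field_simp
        nlinarith
      push_cast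
      rw [← hs, Matrix.smul_mul, Matrix.mul_smul, smul_smul]
      ext i j
      fin_cases i <;> fin_cases j <;> simp [Matrix.mul_apply, Fin.sum_univ_two] <;> ring
  inv_mem' := by
    rintro γ ⟨a, b, c, d, e, he, hdet, heN, hea, hed, hNc, hγ⟩
    refine ⟨d, -b, -c, a, e, he, by linarith, heN, hed, hea, (dvd_neg).2 hNc, ?_⟩
    rw [Matrix.SpecialLinearGroup.coe_inv, hγ, Matrix.adjugate_fin_two]
    ext i j
    fin_cases i <;> fin_cases j <;> simp

/-- The parabolic subgroup `Γ_∞(N)`: the stabilizer of the cusp `i∞` in `Γ₀(N)⁺`, that is, the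
elements with lower left entry `0` (so `-1` belongs to it). -/
noncomputable def parabolicSubgroup (N : ℕ) : Subgroup (moonshineGroup N) where
  carrier := {γ | (γ : SL(2, ℝ)) 1 0 = 0}
  one_mem' := by simp
  mul_mem' := by
    intro γ γ' h h'
    simp only [Set.mem_ofPred_eq] at h h' ⊢
    simp [Matrix.mul_apply, Fin.sum_univ_two, h, h']
  inv_mem' := by
    intro γ h
    simp only [Set.mem_ofPred_eq] at h ⊢
    simp [Matrix.SpecialLinearGroup.coe_inv, Matrix.adjugate_fin_two, h]

/-- The elements of `Γ_∞(N)` preserve imaginary parts. -/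
theorem im_parabolic_smul (N : ℕ) (δ : moonshineGroup N) (hδ : δ ∈ parabolicSubgroup N)
    (w : UpperHalfPlane) : ((δ : SL(2, ℝ)) • w).im = w.im := by
  obtain ⟨δ, a, b, c, d, e, he, hdet, heN, ⟨α, rfl⟩, ⟨β, rfl⟩, hNc, hγ⟩ := δ
  have h10 : δ 1 0 = 0 := hδ
  have heR : (0 : ℝ) < e := by exact_mod_cast he
  have hs := (Real.sqrt_pos.2 heR).ne'
  have hc : c = 0 := by
    rw [hγ] at h10
    simpa [hs] using h10
  subst hc
  have h1 : e * (α * β) = 1 := by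
    apply mul_left_cancel₀ he.ne'
    linear_combination hdet
  have he1 : e = 1 := Int.eq_one_of_dvd_one he.le ⟨_, h1.symm⟩
  subst he1
  have hβ : (β : ℝ) ^ 2 = 1 := by
    have : β ∣ 1 := ⟨α, by linarith⟩
    rcases Int.isUnit_iff.1 (isUnit_of_dvd_one this) with h | h <;> simp [h]
  have h11 : δ 1 1 = β := by rw [hγ]; simp
  have := UpperHalfPlane.im_smul_eq_div_normSq (δ : GL (Fin 2) ℝ) w
  change ((δ : GL (Fin 2) ℝ) • w).im = w.im
  rw [this]
  simp [UpperHalfPlane.denom, h10, h11, Complex.normSq_apply]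
  rw [← sq, hβ, div_one]

/-- The coset space `Γ_∞(N) \ Γ₀(N)⁺` (the classes `Γ_∞(N) γ`). -/
abbrev ParabolicCosets (N : ℕ) : Type :=
  Quotient (QuotientGroup.rightRel (parabolicSubgroup N))

/-- The function `Γ_∞(N) γ ↦ Im (γ z)` on `Γ_∞(N) \ Γ₀(N)⁺`. -/
noncomputable def cosetIm (N : ℕ) (z : UpperHalfPlane) : ParabolicCosets N → ℝ :=
  Quotient.lift (fun γ : moonshineGroup N => ((γ : SL(2, ℝ)) • z).im) (by
    intro γ γ' h
    have h' : γ' * γ⁻¹ ∈ parabolicSubgroup N := QuotientGroup.rightRel_apply.1 h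
    have := im_parabolic_smul N _ h' ((γ : SL(2, ℝ)) • z)
    rw [← mul_smul] at this
    simpa using this.symm)

/-- `E` is the function `s ↦ ℰ_∞(z, s)` on the whole complex plane: it is meromorphic on `ℂ`, and
for `Re s > 1` it is the sum of the (convergent) series `∑ Im (γ z)^s` over
`γ ∈ Γ_∞(N) \ Γ₀(N)⁺`. Normal form of a meromorphic function means that it takes its limiting value
at every point that is not a pole and the conventional value `0` at the poles; this makes `E` unique
as a function `ℂ → ℂ`. -/
structure IsRealAnalyticEisenstein (N : ℕ) (z : UpperHalfPlane) (E : ℂ → ℂ) : Prop where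
  meromorphic : MeromorphicNFOn E Set.univ
  hasSum : ∀ s : ℂ, 1 < s.re →
    HasSum (fun γ : ParabolicCosets N => (cosetIm N z γ : ℂ) ^ s) (E s)

/-! The lower row of an element of `Γ₀(N)⁺` has the form `√e (C, D)` with `C`, `D` coprime and, as
`N` is squarefree, `e = N / gcd(N, C)`. Hence `Γ_∞(N) \ Γ₀(N)⁺` is the set of primitive pairs up to
sign, and `Im (γ z) = (gcd(N, C) / N) · y / |Cz + D|²`.

Let `E₁` be the level one series, the sum of `(y / |Cz + D|²)^s` over the same pairs. Rewriting
`E₁(vz, s)` as a sum over the primitive pairs of `z` inserts the factor `(gcd(v, C)² / v)^s`. Summed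
over `v ∣ N`, these factors give `(gcd(N, C) / N)^s · ∑ v^s`. Therefore `ℰ_∞(z, s) = ∑ E₁(vz, s) / ∑
v^s` (`sum_divisors_gcd_sq_div`, `hasSum_primPairs_gcd`, `hasSum_cosetIm_cpow`).

The continuation of `E₁` comes from its Fourier expansion. For each `m > 0` the sum over `n` of `|mz
+ n|^{-2s}` is a Mellin transform of a theta kernel, and the theta functional equation turns it into
a Gamma factor plus `K`-Bessel terms that decay exponentially and are entire in `s`
(`mellin_evenKernel_mul_exp`, `hasSum_upper_latticeNormSq`). Dividing by `ζ(2s)` passes from all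
pairs to primitive ones, so `E₁ = y^s (1 + T(s) / (Γ(s) ζ(2s)))` with `T` meromorphic.

At `s = 0` the factor `1 / Γ(s)` vanishes to first order, so `E₁ = 1 + (log y + T(0) / ζ(0)) s +
O(s²)`. The Bessel terms at `s = 0` are elementary and sum to the logarithm of the eta product,
whence `T(0) = -2 log |η(z)|`, and `ζ(0) = -1/2` (`eisensteinTail_zero`,
`hasDerivAt_levelOneEisenstein_zero`). In the quotient over `v ∣ N` the terms `log v` cancel against
the derivative of `∑ v^s`. -/

open MeasureTheory Set Filter Asymptotics
open HurwitzZeta UpperHalfPlane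

/-! ### The Mellin transform of `exp (-(A / t + B t))` -/

/-- The integrand `exp (-(A / t + B t))` of the `K`-Bessel function. -/
noncomputable def expKernel (A B t : ℝ) : ℝ := Real.exp (-(A / t + B * t))

theorem expKernel_pos (A B t : ℝ) : 0 < expKernel A B t := Real.exp_pos _

theorem continuousOn_expKernel (A B : ℝ) : ContinuousOn (expKernel A B) (Ioi 0) := by
  unfold expKernel
  refine Real.continuous_exp.comp_continuousOn (ContinuousOn.neg (ContinuousOn.add ?_ (by fun_prop)))
  exact continuousOn_const.div continuousOn_id fun t ht => (ne_of_gt ht)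

theorem expKernel_isBigO_atTop {A : ℝ} (hA : 0 < A) (B : ℝ) :
    (fun t => (expKernel A B t : ℂ)) =O[atTop] fun t => Real.exp (-B * t) := by
  refine IsBigO.of_bound 1 ?_
  filter_upwards [eventually_gt_atTop 0] with t ht
  rw [Complex.norm_real, Real.norm_of_nonneg (expKernel_pos _ _ _).le,
    Real.norm_of_nonneg (Real.exp_pos _).le, one_mul]
  refine Real.exp_le_exp.2 ?_
  have : 0 < A / t := by positivity
  linarith

/-- Under `t ↦ 1 / t` the factor `exp (-A / t)` becomes exponential decay at infinity, which beats
every power. With the decay at infinity this makes the Mellin transform entire. -/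
theorem expKernel_isBigO_zero {A B : ℝ} (hA : 0 < A) (hB : 0 < B) (b : ℝ) :
    (fun t => (expKernel A B t : ℂ)) =O[𝓝[>] 0] fun t : ℝ => t ^ (-b) := by
  have h1 : (fun t : ℝ => Real.exp (-A * t)) =O[atTop] fun t => t ^ b :=
    (isLittleO_exp_neg_mul_rpow_atTop hA b).isBigO
  have h2 := h1.comp_tendsto tendsto_inv_nhdsGT_zero
  refine IsBigO.trans ?_ (h2.trans ?_)
  · refine IsBigO.of_bound 1 ?_
    filter_upwards [self_mem_nhdsWithin] with t (ht : 0 < t)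
    rw [Complex.norm_real, Real.norm_of_nonneg (expKernel_pos _ _ _).le, Function.comp_apply,
      Real.norm_of_nonneg (Real.exp_pos _).le, one_mul]
    refine Real.exp_le_exp.2 ?_
    have : 0 < B * t := by positivity
    rw [div_eq_mul_inv]
    linarith
  · refine IsBigO.of_bound 1 ?_
    filter_upwards [self_mem_nhdsWithin] with t (ht : 0 < t)
    rw [Function.comp_apply, Real.inv_rpow ht.le, Real.rpow_neg ht.le, one_mul]

theorem locallyIntegrableOn_expKernel (A B : ℝ) :
    LocallyIntegrableOn (fun t => (expKernel A B t : ℂ)) (Ioi 0) :=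
  (Complex.continuous_ofReal.comp_continuousOn (continuousOn_expKernel A B)).locallyIntegrableOn
    measurableSet_Ioi

theorem mellinConvergent_expKernel {A B : ℝ} (hA : 0 < A) (hB : 0 < B) (s : ℂ) :
    MellinConvergent (fun t => (expKernel A B t : ℂ)) s :=
  mellinConvergent_of_isBigO_rpow_exp hB (locallyIntegrableOn_expKernel A B)
    (expKernel_isBigO_atTop hA B) (expKernel_isBigO_zero hA hB (s.re - 1)) (by linarith)

theorem differentiable_mellin_expKernel {A B : ℝ} (hA : 0 < A) (hB : 0 < B) :
    Differentiable ℂ (mellin fun t => (expKernel A B t : ℂ)) := fun s =>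
  mellin_differentiableAt_of_isBigO_rpow_exp hB (locallyIntegrableOn_expKernel A B)
    (expKernel_isBigO_atTop hA B) (expKernel_isBigO_zero hA hB (s.re - 1)) (by linarith)

theorem integrableOn_rpow_mul_expKernel {A B : ℝ} (hA : 0 < A) (hB : 0 < B) (σ : ℝ) :
    IntegrableOn (fun t => t ^ (σ - 1) * expKernel A B t) (Ioi 0) := by
  have := (mellinConvergent_expKernel hA hB σ).norm
  refine IntegrableOn.congr_fun this (fun t (ht : 0 < t) => ?_) measurableSet_Ioi
  simp only [norm_smul, Complex.norm_real, Real.norm_of_nonneg (expKernel_pos A B t).le,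
    Complex.norm_cpow_eq_rpow_re_of_pos ht, Complex.sub_re, Complex.ofReal_re, Complex.one_re]

theorem norm_mellin_expKernel_le (A B : ℝ) (s : ℂ) :
    ‖mellin (fun t => (expKernel A B t : ℂ)) s‖ ≤
      ∫ t in Ioi 0, t ^ (s.re - 1) * expKernel A B t := by
  refine (norm_integral_le_integral_norm _).trans_eq ?_
  refine setIntegral_congr_fun measurableSet_Ioi fun t (ht : 0 < t) => ?_
  simp only [norm_smul, Complex.norm_real, Real.norm_of_nonneg (expKernel_pos A B t).le,
    Complex.norm_cpow_eq_rpow_re_of_pos ht, Complex.sub_re, Complex.one_re]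

/-- Half of the exponent is at least `√(A B)` by AM-GM, and the other half is monotone in `A` and
`B`. The result is exponential decay in the parameters against a fixed integrable kernel. -/
theorem expKernel_le {A₀ B₀ A B t : ℝ} (hA₀ : 0 < A₀) (hB₀ : 0 < B₀) (hA : A₀ ≤ A) (hB : B₀ ≤ B)
    (ht : 0 < t) :
    expKernel A B t ≤ Real.exp (-√(A * B)) * expKernel (A₀ / 2) (B₀ / 2) t := by
  unfold expKernel
  rw [← Real.exp_add]
  refine Real.exp_le_exp.2 ?_
  have hA' : 0 < A := hA₀.trans_le hA
  have hB' : 0 < B := hB₀.trans_le hB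
  have h1 : √(A * B) ≤ A / t / 2 + B * t / 2 := by
    refine Real.sqrt_le_iff.2 ⟨by positivity, ?_⟩
    have : A * B = A / t * (B * t) := by field_simp
    rw [this]
    nlinarith [sq_nonneg (A / t - B * t)]
  have h2 : A₀ / 2 / t ≤ A / t / 2 := by
    rw [div_right_comm]; gcongr
  have h3 : B₀ / 2 * t ≤ B * t / 2 := by
    rw [div_mul_eq_mul_div]; gcongr
  linarith

theorem norm_mellin_expKernel_le_of_le {A₀ B₀ A B σ₁ σ₂ : ℝ} (hA₀ : 0 < A₀) (hB₀ : 0 < B₀)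
    (hA : A₀ ≤ A) (hB : B₀ ≤ B) {s : ℂ} (h1 : σ₁ ≤ s.re) (h2 : s.re ≤ σ₂) :
    ‖mellin (fun t => (expKernel A B t : ℂ)) s‖ ≤
      Real.exp (-√(A * B)) *
        ((∫ t in Ioi 0, t ^ (σ₁ - 1) * expKernel (A₀ / 2) (B₀ / 2) t) +
          ∫ t in Ioi 0, t ^ (σ₂ - 1) * expKernel (A₀ / 2) (B₀ / 2) t) := by
  refine (norm_mellin_expKernel_le A B s).trans ?_
  have i1 := integrableOn_rpow_mul_expKernel (half_pos hA₀) (half_pos hB₀) σ₁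
  have i2 := integrableOn_rpow_mul_expKernel (half_pos hA₀) (half_pos hB₀) σ₂
  rw [← integral_add i1 i2, ← integral_const_mul]
  refine setIntegral_mono_on (integrableOn_rpow_mul_expKernel (hA₀.trans_le hA) (hB₀.trans_le hB) _)
    ((i1.add i2).const_mul _) measurableSet_Ioi fun t (ht : 0 < t) => ?_
  have hk := expKernel_le hA₀ hB₀ hA hB ht
  have hp : t ^ (s.re - 1) ≤ t ^ (σ₁ - 1) + t ^ (σ₂ - 1) := by
    rcases le_total t 1 with h | h
    · have := Real.rpow_le_rpow_of_exponent_ge ht h (show σ₁ - 1 ≤ s.re - 1 by linarith)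
      have : 0 < t ^ (σ₂ - 1) := by positivity
      linarith
    · have := Real.rpow_le_rpow_of_exponent_le h (show s.re - 1 ≤ σ₂ - 1 by linarith)
      have : 0 < t ^ (σ₁ - 1) := by positivity
      linarith
  calc t ^ (s.re - 1) * expKernel A B t
      ≤ (t ^ (σ₁ - 1) + t ^ (σ₂ - 1)) *
          (Real.exp (-√(A * B)) * expKernel (A₀ / 2) (B₀ / 2) t) :=
        mul_le_mul hp hk (expKernel_pos _ _ _).le (by positivity)
    _ = _ := by ring

theorem expKernel_comp_inv {A B : ℝ} (hA : 0 < A) (hB : 0 < B) (t : ℝ) :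
    expKernel A B (A / B * t⁻¹) = expKernel A B t := by
  unfold expKernel
  rcases eq_or_ne t 0 with rfl | ht
  · simp
  · congr 2
    field_simp
    ring

theorem mellin_expKernel_symm {A B : ℝ} (hA : 0 < A) (hB : 0 < B) (s : ℂ) :
    mellin (fun t => (expKernel A B t : ℂ)) s =
      ((A / B : ℝ) : ℂ) ^ s * mellin (fun t => (expKernel A B t : ℂ)) (-s) := by
  have h1 := mellin_comp_inv (fun t => (expKernel A B (A / B * t) : ℂ)) s
  have h2 := mellin_comp_mul_left (fun t => (expKernel A B t : ℂ)) (-s) (div_pos hA hB)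
  simp only [expKernel_comp_inv hA hB] at h1
  rw [h1, h2, neg_neg, smul_eq_mul]

/-- The substitution `u = b √t - a / √t` maps `(0, ∞)` bijectively onto the real line, and the
bracket is `du / dt`; what remains is the Gaussian integral. -/
theorem integral_exp_neg_sq_sub {a b : ℝ} (ha : 0 < a) (hb : 0 < b) :
    ∫ t in Ioi (0 : ℝ), (b / (2 * √t) + a / (2 * (√t * t))) * Real.exp (-(b * √t - a / √t) ^ 2) =
      √Real.pi := by
  set φ : ℝ → ℝ := fun t => b * √t - a / √t with hφ
  have hderiv : ∀ t ∈ Ioi (0 : ℝ),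
      HasDerivWithinAt φ (b / (2 * √t) + a / (2 * (√t * t))) (Ioi 0) t := by
    intro t (ht : 0 < t)
    have hs : 0 < √t := Real.sqrt_pos.2 ht
    have h := Real.hasDerivAt_sqrt ht.ne'
    have := ((h.const_mul b).sub (((h.fun_inv hs.ne').const_mul a))).hasDerivWithinAt (s := Ioi 0)
    convert! this using 1
    rw [Real.sq_sqrt ht.le]
    field_simp
    ring
  have hpos : ∀ t ∈ Ioi (0 : ℝ), 0 < b / (2 * √t) + a / (2 * (√t * t)) := by
    intro t (ht : 0 < t)
    have hs : 0 < √t := Real.sqrt_pos.2 ht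
    positivity
  have hinj : InjOn φ (Ioi 0) := by
    refine StrictMonoOn.injOn fun s (hs : 0 < s) t (ht : 0 < t) hst => ?_
    have h1 : √s < √t := Real.sqrt_lt_sqrt hs.le hst
    have h0 : 0 < √s := Real.sqrt_pos.2 hs
    simp only [hφ]
    have h2 : a / √t < a / √s := by gcongr
    nlinarith
  have himg : φ '' Ioi 0 = univ := by
    refine eq_univ_of_forall fun u => ?_
    -- The positive root of `b w² - u w - a = 0`; the preimage of `u` is `t = w²`.
    set w := (u + √(u ^ 2 + 4 * a * b)) / (2 * b) with hw
    have hr : |u| < √(u ^ 2 + 4 * a * b) := by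
      rw [← Real.sqrt_sq_eq_abs]
      exact Real.sqrt_lt_sqrt (sq_nonneg _) (by nlinarith [mul_pos ha hb])
    have hw0 : 0 < w := by
      have := neg_abs_le u
      exact div_pos (by linarith) (by positivity)
    refine ⟨w ^ 2, by simp only [mem_Ioi]; positivity, ?_⟩
    simp only [hφ, Real.sqrt_sq hw0.le]
    have hsq := Real.sq_sqrt (show 0 ≤ u ^ 2 + 4 * a * b by positivity)
    have hroot : b * w ^ 2 - u * w - a = 0 := by
      have hw2 : 2 * b * w = u + √(u ^ 2 + 4 * a * b) := by rw [hw]; field_simp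
      have : (2 * b * w - u) ^ 2 = u ^ 2 + 4 * a * b := by rw [← hsq, hw2]; ring
      have h4 : 4 * b * (b * w ^ 2 - u * w - a) = 0 := by linear_combination this
      exact (mul_eq_zero.1 h4).resolve_left (by positivity)
    field_simp
    linarith
  have key := integral_image_eq_integral_abs_deriv_smul measurableSet_Ioi hderiv hinj
    (fun u => Real.exp (-u ^ 2))
  rw [himg, setIntegral_univ] at key
  have hg := integral_gaussian 1
  simp only [neg_mul, one_mul, div_one] at hg
  rw [← hg, key]
  refine setIntegral_congr_fun measurableSet_Ioi fun t ht => ?_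
  simp only [abs_of_pos (hpos t ht), smul_eq_mul, hφ]

/-- The elementary case of the Bessel function, of order one half. The previous integral is a
combination of the Mellin transforms at `1/2` and `-1/2`, and the symmetry `t ↦ A / (B t)` expresses
one through the other. -/
theorem mellin_expKernel_neg_half {a b : ℝ} (ha : 0 < a) (hb : 0 < b) :
    mellin (fun t => (expKernel (a ^ 2) (b ^ 2) t : ℂ)) (-1 / 2) =
      ((√Real.pi / a * Real.exp (-(2 * a * b)) : ℝ) : ℂ) := by
  have ha2 : 0 < a ^ 2 := by positivity
  have hb2 : 0 < b ^ 2 := by positivity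
  have hmel : ∀ σ : ℝ, mellin (fun t => (expKernel (a ^ 2) (b ^ 2) t : ℂ)) σ =
      ((∫ t in Ioi 0, t ^ (σ - 1) * expKernel (a ^ 2) (b ^ 2) t : ℝ) : ℂ) := by
    intro σ
    rw [mellin, ← integral_complex_ofReal]
    refine setIntegral_congr_fun measurableSet_Ioi fun t (ht : 0 < t) => ?_
    simp only [smul_eq_mul, Complex.ofReal_mul]
    rw [Complex.ofReal_cpow ht.le]
    push_cast
    rfl
  have hsymm := mellin_expKernel_symm ha2 hb2 ((1 / 2 : ℝ) : ℂ)
  have hneg : -((1 / 2 : ℝ) : ℂ) = ((-1 / 2 : ℝ) : ℂ) := by push_cast; ring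
  rw [hneg, hmel, hmel, ← Complex.ofReal_cpow (by positivity), ← Complex.ofReal_mul,
    Complex.ofReal_inj, ← Real.sqrt_eq_rpow, Real.sqrt_div' _ (by positivity),
    Real.sqrt_sq ha.le, Real.sqrt_sq hb.le] at hsymm
  have hcast : (-1 / 2 : ℂ) = ((-1 / 2 : ℝ) : ℂ) := by push_cast; ring
  rw [hcast, hmel, Complex.ofReal_inj]
  have i1 := integrableOn_rpow_mul_expKernel ha2 hb2 (1 / 2)
  have i2 := integrableOn_rpow_mul_expKernel ha2 hb2 (-1 / 2)
  have key : b / 2 * (∫ t in Ioi 0, t ^ ((1 / 2 : ℝ) - 1) * expKernel (a ^ 2) (b ^ 2) t) +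
      a / 2 * (∫ t in Ioi 0, t ^ ((-1 / 2 : ℝ) - 1) * expKernel (a ^ 2) (b ^ 2) t) =
      Real.exp (-(2 * a * b)) * √Real.pi := by
    rw [← integral_exp_neg_sq_sub ha hb, ← integral_const_mul, ← integral_const_mul,
      ← integral_const_mul, ← integral_add (i1.const_mul _) (i2.const_mul _)]
    refine setIntegral_congr_fun measurableSet_Ioi fun t (ht : 0 < t) => ?_
    have hs : 0 < √t := Real.sqrt_pos.2 ht
    have e1 : t ^ ((1 / 2 : ℝ) - 1) = 1 / √t := by
      rw [show (1 / 2 : ℝ) - 1 = -(1 / 2) by norm_num, Real.rpow_neg ht.le, ← Real.sqrt_eq_rpow,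
        one_div]
    have e2 : t ^ ((-1 / 2 : ℝ) - 1) = 1 / (√t * t) := by
      rw [show (-1 / 2 : ℝ) - 1 = -(1 / 2 + 1) by norm_num, Real.rpow_neg ht.le,
        Real.rpow_add ht, ← Real.sqrt_eq_rpow, Real.rpow_one, one_div]
    have e3 : Real.exp (-(2 * a * b)) * Real.exp (-(b * √t - a / √t) ^ 2) =
        expKernel (a ^ 2) (b ^ 2) t := by
      rw [expKernel, ← Real.exp_add]
      congr 1
      have : t = √t ^ 2 := (Real.sq_sqrt ht.le).symm
      have h' : a ^ 2 / t = a ^ 2 / √t ^ 2 := by rw [← this]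
      rw [h']
      conv_rhs => rw [this]
      rw [Real.sqrt_sq hs.le]
      field_simp
      ring
    simp only [e1, e2]
    rw [← e3]
    field_simp
  rw [hsymm] at key
  field_simp at key ⊢
  linarith

/-! ### The form `|m z + n|²` and convergence of its lattice sums -/

/-- The binary quadratic form `|m z + n|²`. -/
noncomputable def latticeNormSq (z : ℍ) (x : ℤ × ℤ) : ℝ := Complex.normSq (x.1 * z + x.2)

theorem latticeNormSq_eq (z : ℍ) (x : ℤ × ℤ) :
    latticeNormSq z x = (x.2 + x.1 * z.re) ^ 2 + (x.1 * z.im) ^ 2 := by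
  simp [latticeNormSq, Complex.normSq_apply]
  ring

theorem latticeNormSq_pos (z : ℍ) {x : ℤ × ℤ} (hx : x ≠ 0) : 0 < latticeNormSq z x := by
  rw [latticeNormSq_eq]
  have hz := z.im_pos
  rcases eq_or_ne x.1 0 with h | h
  · have h2 : x.2 ≠ 0 := fun h2 => hx (Prod.ext h h2)
    have : (x.2 : ℝ) ≠ 0 := by exact_mod_cast h2
    rw [h]
    simp
    positivity
  · have : (x.1 : ℝ) ≠ 0 := by exact_mod_cast h
    positivity

theorem latticeNormSq_nonneg (z : ℍ) (x : ℤ × ℤ) : 0 ≤ latticeNormSq z x := Complex.normSq_nonneg _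

theorem summable_latticeNormSq_rpow (z : ℍ) {σ : ℝ} (hσ : 1 < σ) :
    Summable fun x : ℤ × ℤ => (1 : ℝ) / latticeNormSq z x ^ σ := by
  have h1 := (EisensteinSeries.summable_one_div_norm_rpow
    (show (2 : ℝ) < 2 * σ by linarith)).mul_left (EisensteinSeries.r z ^ (-(2 * σ)))
  have h2 : Summable fun x : Fin 2 → ℤ => ‖(x 0 : ℂ) * z + x 1‖ ^ (-(2 * σ)) :=
    h1.of_nonneg_of_le (fun x => by positivity)
      (fun x => EisensteinSeries.summand_bound z (by linarith) x)
  rw [← (finTwoArrowEquiv ℤ).symm.summable_iff] at h2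
  refine h2.congr fun x => ?_
  simp only [Function.comp_apply, finTwoArrowEquiv_symm_apply, Matrix.cons_val_zero,
    Matrix.cons_val_one]
  rw [latticeNormSq, Complex.normSq_eq_norm_sq, Real.rpow_neg (norm_nonneg _),
    Real.rpow_mul (norm_nonneg _), one_div, Real.rpow_two]

theorem summable_latticeNormSq_cpow (z : ℍ) {s : ℂ} (hs : 1 < s.re) :
    Summable fun x : ℤ × ℤ => (1 : ℂ) / (latticeNormSq z x : ℂ) ^ s := by
  refine Summable.of_norm ((summable_latticeNormSq_rpow z hs).congr fun x => ?_)
  have h0 : 0 ≤ latticeNormSq z x := Complex.normSq_nonneg _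
  rw [norm_div, norm_one, Complex.norm_cpow_eq_rpow_re_of_nonneg h0 (by linarith)]

/-! ### Fourier expansion of the sum over nonzero pairs up to sign -/

/-- The `k`-th Fourier term of `∑ₙ |w + n + iY|^{-2s}`, up to elementary factors. -/
noncomputable def besselTerm (w Y : ℝ) (s : ℂ) (k : ℕ) : ℂ :=
  2 * Real.cos (2 * Real.pi * w * (k + 1)) *
    mellin (fun t => (expKernel (Real.pi * (k + 1) ^ 2) (Real.pi * Y ^ 2) t : ℂ)) (s - 1 / 2)

theorem sqrt_expKernel_parameters {Y : ℝ} (hY : 0 < Y) (k : ℕ) :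
    √(Real.pi * (k + 1) ^ 2 * (Real.pi * Y ^ 2)) = Real.pi * (k + 1) * Y := by
  rw [show Real.pi * ((k : ℝ) + 1) ^ 2 * (Real.pi * Y ^ 2) = (Real.pi * (k + 1) * Y) ^ 2 by ring,
    Real.sqrt_sq (by positivity)]

theorem summable_exp_neg_mul_succ {c : ℝ} (hc : 0 < c) :
    Summable fun k : ℕ => Real.exp (-(c * (k + 1))) := by
  have h : Summable fun k : ℕ => Real.exp (-c) * Real.exp (-c) ^ k :=
    (summable_geometric_of_lt_one (Real.exp_pos _).le
      (by rw [← Real.exp_zero]; exact Real.exp_lt_exp.2 (by linarith))).mul_left _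
  refine h.congr fun k => ?_
  rw [← Real.exp_nat_mul, ← Real.exp_add]
  congr 1
  ring

theorem hasSum_cosKernel_mul_exp (w Y : ℝ) {t : ℝ} (ht : 0 < t) :
    HasSum (fun k : ℕ => 2 * Real.cos (2 * Real.pi * w * (k + 1)) *
        expKernel (Real.pi * (k + 1) ^ 2) (Real.pi * Y ^ 2) t)
      ((cosKernel w (1 / t) - 1) * Real.exp (-(Real.pi * Y ^ 2 * t))) := by
  have h := (hasSum_nat_cosKernel₀ w (one_div_pos.2 ht)).mul_right
    (Real.exp (-(Real.pi * Y ^ 2 * t)))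
  refine h.congr_fun fun k => ?_
  rw [mul_assoc _ (Real.exp _) (Real.exp _), ← Real.exp_add, expKernel]
  congr 2
  ring

/-- The functional equation replaces `evenKernel w t` by `t^{-1/2} cosKernel w (1 / t)`. The
constant term of the cosine series integrates to the Gamma factor and the other terms to the Bessel
terms; the exponential bound in `k` justifies termwise integration. -/
theorem mellin_evenKernel_mul_exp (w : ℝ) {Y : ℝ} (hY : 0 < Y) {s : ℂ} (hs : 1 / 2 < s.re) :
    HasSum (besselTerm w Y s)
      (mellin (fun t => ((evenKernel w t * Real.exp (-(Real.pi * Y ^ 2 * t)) : ℝ) : ℂ)) s -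
        Complex.Gamma (s - 1 / 2) * (Real.pi * Y ^ 2 : ℝ) ^ (1 / 2 - s)) := by
  have hπ := Real.pi_pos
  have hA : ∀ k : ℕ, 0 < Real.pi * ((k : ℝ) + 1) ^ 2 := fun k => by positivity
  have hB : 0 < Real.pi * Y ^ 2 := by positivity
  have hre : (0 : ℝ) < (s - 1 / 2).re := by
    have : (s - 1 / 2).re = s.re - 1 / 2 := by simp
    rw [this]; linarith
  set F : ℕ → ℝ → ℂ := fun k t => (t : ℂ) ^ (s - 1 / 2 - 1) *
    ((2 * Real.cos (2 * Real.pi * w * (k + 1)) : ℝ) *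
      (expKernel (Real.pi * (k + 1) ^ 2) (Real.pi * Y ^ 2) t : ℂ)) with hF
  have hmc : ∀ k : ℕ, IntegrableOn (fun t : ℝ => (t : ℂ) ^ (s - 1 / 2 - 1) *
      (expKernel (Real.pi * (k + 1) ^ 2) (Real.pi * Y ^ 2) t : ℂ)) (Ioi 0) := fun k =>
    mellinConvergent_expKernel (hA k) hB (s - 1 / 2)
  have hFint : ∀ k, IntegrableOn (F k) (Ioi 0) := fun k => by
    refine IntegrableOn.congr_fun ((hmc k).const_mul
      ((2 * Real.cos (2 * Real.pi * w * (k + 1)) : ℝ) : ℂ)) (fun t _ => ?_) measurableSet_Ioi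
    simp only [hF]; ring
  set σ := (s - 1 / 2).re with hσ
  set M := (∫ t in Ioi 0, t ^ (σ - 1) * expKernel (Real.pi / 2) (Real.pi * Y ^ 2 / 2) t) with hM
  have i1 : IntegrableOn (fun t => t ^ (σ - 1) * expKernel (Real.pi / 2) (Real.pi * Y ^ 2 / 2) t)
      (Ioi 0) := integrableOn_rpow_mul_expKernel (half_pos hπ) (half_pos hB) σ
  have hnorm : ∀ k, ∀ t ∈ Ioi (0 : ℝ), ‖F k t‖ ≤
      t ^ (σ - 1) * expKernel (Real.pi / 2) (Real.pi * Y ^ 2 / 2) t *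
        (2 * Real.exp (-(Real.pi * Y * (k + 1)))) := by
    intro k t (ht : 0 < t)
    have hle := expKernel_le hπ hB (show Real.pi ≤ Real.pi * ((k : ℝ) + 1) ^ 2 by
      nlinarith [Nat.cast_nonneg (α := ℝ) k, mul_nonneg hπ.le (Nat.cast_nonneg (α := ℝ) k)])
      le_rfl ht
    rw [sqrt_expKernel_parameters hY] at hle
    have hcos : ‖((2 * Real.cos (2 * Real.pi * w * (k + 1)) : ℝ) : ℂ)‖ ≤ 2 := by
      rw [Complex.norm_real, Real.norm_eq_abs, abs_mul, abs_two]
      linarith [Real.abs_cos_le_one (2 * Real.pi * w * (k + 1))]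
    have hcpow : ‖(t : ℂ) ^ (s - 1 / 2 - 1)‖ = t ^ (σ - 1) := by
      rw [Complex.norm_cpow_eq_rpow_re_of_pos ht, Complex.sub_re, Complex.one_re]
    rw [hF, norm_mul, norm_mul, hcpow, Complex.norm_real (expKernel _ _ _),
      Real.norm_of_nonneg (expKernel_pos _ _ _).le]
    refine (mul_le_mul_of_nonneg_left
      (mul_le_mul hcos hle (expKernel_pos _ _ _).le zero_le_two) (by positivity)).trans_eq ?_
    rw [mul_right_comm Real.pi]
    ring
  have hbound : ∀ k, ∫ t in Ioi 0, ‖F k t‖ ≤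
      M * (2 * Real.exp (-(Real.pi * Y * (k + 1)))) := by
    intro k
    rw [hM, ← integral_mul_const]
    exact setIntegral_mono_on (hFint k).norm (i1.mul_const _) measurableSet_Ioi (hnorm k)
  have hsexp : Summable fun k : ℕ => 2 * Real.exp (-(Real.pi * Y * (k + 1))) :=
    (summable_exp_neg_mul_succ (mul_pos hπ hY)).mul_left 2
  have hsum : Summable fun k => ∫ t in Ioi 0, ‖F k t‖ :=
    (hsexp.mul_left M).of_nonneg_of_le
      (fun k => integral_nonneg fun t => norm_nonneg _) hbound
  have key := hasSum_integral_of_summable_integral_norm hFint hsum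
  have hterm : (fun k => ∫ t in Ioi 0, F k t) = besselTerm w Y s := by
    funext k
    rw [besselTerm, mellin, ← integral_const_mul]
    refine setIntegral_congr_fun measurableSet_Ioi fun t _ => ?_
    simp only [hF, smul_eq_mul]
    push_cast
    ring
  have hpoint : ∀ t ∈ Ioi (0 : ℝ), ∑' k, F k t =
      (t : ℂ) ^ (s - 1) * ((evenKernel w t * Real.exp (-(Real.pi * Y ^ 2 * t)) : ℝ) : ℂ) -
        (t : ℂ) ^ (s - 1 / 2 - 1) * Complex.exp (-((Real.pi * Y ^ 2 : ℝ) * t)) := by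
    intro t (ht : 0 < t)
    have h := (Complex.hasSum_ofReal.2 (hasSum_cosKernel_mul_exp w Y ht)).mul_left
      ((t : ℂ) ^ (s - 1 / 2 - 1))
    have h' : HasSum (fun k => F k t) _ := h.congr_fun fun k => by simp only [hF]; push_cast; ring
    rw [h'.tsum_eq, evenKernel_functional_equation]
    have ht' : (t : ℂ) ≠ 0 := by exact_mod_cast ht.ne'
    have e : (t : ℂ) ^ (s - 1) * ((1 / t ^ (1 / 2 : ℝ) : ℝ) : ℂ) = (t : ℂ) ^ (s - 1 / 2 - 1) := by
      rw [one_div, ← Real.rpow_neg ht.le, Complex.ofReal_cpow ht.le, ← Complex.cpow_add _ _ ht']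
      congr 1
      push_cast
      ring
    rw [← e]
    push_cast
    ring
  have hG := Complex.integral_cpow_mul_exp_neg_mul_Ioi hre hB
  have hGint : IntegrableOn (fun t : ℝ => (t : ℂ) ^ (s - 1 / 2 - 1) *
      Complex.exp (-((Real.pi * Y ^ 2 : ℝ) * t))) (Ioi 0) := by
    -- The integral of a non-integrable function is `0` by convention, whereas this one is a nonzero
    -- Gamma value.
    by_contra h
    have h0 := integral_undef h
    rw [hG] at h0
    refine mul_ne_zero ?_ (Complex.Gamma_ne_zero_of_re_pos hre) h0
    rw [Complex.cpow_ne_zero_iff]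
    exact Or.inl (one_div_ne_zero (by exact_mod_cast hB.ne'))
  have hcont : ContinuousOn (fun t => ∑' k, F k t) (Ioi 0) := by
    refine ContinuousOn.congr (ContinuousOn.sub (ContinuousOn.mul ?_ ?_)
      (ContinuousOn.mul ?_ (by fun_prop))) hpoint
    · exact ContinuousOn.cpow_const (by fun_prop) fun t (ht : 0 < t) =>
        Complex.ofReal_mem_slitPlane.2 ht
    · exact Complex.continuous_ofReal.comp_continuousOn
        ((continuousOn_evenKernel _).mul (by fun_prop))
    · exact ContinuousOn.cpow_const (by fun_prop) fun t (ht : 0 < t) =>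
        Complex.ofReal_mem_slitPlane.2 ht
  have hsumint : IntegrableOn (fun t => ∑' k, F k t) (Ioi 0) := by
    refine Integrable.mono' (i1.mul_const (∑' k : ℕ, 2 * Real.exp (-(Real.pi * Y * (k + 1)))))
      (hcont.aestronglyMeasurable measurableSet_Ioi) ?_
    filter_upwards [ae_restrict_mem measurableSet_Ioi] with t ht
    exact tsum_of_norm_bounded (hsexp.hasSum.mul_left _) fun k => hnorm k t ht
  have hEint : IntegrableOn (fun t : ℝ => (t : ℂ) ^ (s - 1) *
      ((evenKernel w t * Real.exp (-(Real.pi * Y ^ 2 * t)) : ℝ) : ℂ)) (Ioi 0) := by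
    refine IntegrableOn.congr_fun (hsumint.add hGint) (fun t ht => ?_) measurableSet_Ioi
    simp only [Pi.add_apply, hpoint t ht]
    ring
  rw [hterm, setIntegral_congr_fun measurableSet_Ioi hpoint, integral_sub hEint hGint, hG] at key
  have e : (1 / ((Real.pi * Y ^ 2 : ℝ) : ℂ)) ^ (s - 1 / 2) =
      ((Real.pi * Y ^ 2 : ℝ) : ℂ) ^ (1 / 2 - s) := by
    rw [one_div, Complex.inv_cpow, ← Complex.cpow_neg, neg_sub]
    rw [Complex.arg_ofReal_of_nonneg hB.le]
    exact hπ.ne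
  rw [e, mul_comm _ (Complex.Gamma _)] at key
  exact key

/-- With `w = m x` and `Y = m y`, the product of the theta kernel and `exp (-π Y² t)` is the sum of
`exp (-π |m z + n|² t)` over `n`. Its Mellin transform can be computed termwise or by the functional
equation. -/
theorem hasSum_int_latticeNormSq (z : ℍ) {m : ℕ} (hm : 0 < m) {s : ℂ} (hs : 1 < s.re) :
    HasSum (fun n : ℤ => (Real.pi : ℂ) ^ (-s) * Complex.Gamma s *
        (1 / (latticeNormSq z (m, n) : ℂ) ^ s))
      (Complex.Gamma (s - 1 / 2) * (Real.pi * (m * z.im) ^ 2 : ℝ) ^ (1 / 2 - s) +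
        ∑' k, besselTerm (m * z.re) (m * z.im) s k) := by
  have hY : 0 < m * z.im := mul_pos (by exact_mod_cast hm) z.im_pos
  have h1 := mellin_evenKernel_mul_exp (m * z.re) hY (show 1 / 2 < s.re by linarith)
  rw [h1.tsum_eq, add_sub_cancel]
  have hpos : ∀ n : ℤ, 0 < latticeNormSq z (m, n) := fun n =>
    latticeNormSq_pos z (by simp [hm.ne'])
  have hF : ∀ t ∈ Ioi (0 : ℝ), HasSum (fun n : ℤ => (1 : ℂ) *
      (Real.exp (-Real.pi * latticeNormSq z (m, n) * t) : ℂ))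
      ((evenKernel ((m * z.re : ℝ) : UnitAddCircle) t *
        Real.exp (-(Real.pi * (m * z.im) ^ 2 * t)) : ℝ) : ℂ) := by
    intro t (ht : 0 < t)
    have h := Complex.hasSum_ofReal.2 ((hasSum_int_evenKernel (m * z.re) ht).mul_right
      (Real.exp (-(Real.pi * (m * z.im) ^ 2 * t))))
    refine h.congr_fun fun n => ?_
    rw [one_mul, ← Real.exp_add, latticeNormSq_eq]
    congr 2
    push_cast
    ring
  have hsum : Summable fun n : ℤ => ‖(1 : ℂ)‖ / latticeNormSq z (m, n) ^ s.re := by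
    simp only [norm_one]
    exact (summable_latticeNormSq_rpow z hs).comp_injective
      (i := fun n : ℤ => ((m : ℤ), n)) (fun a b h => (Prod.ext_iff.1 h).2)
  have h2 := hasSum_mellin_pi_mul (fun n => Or.inr (hpos n)) (show 0 < s.re by linarith) hF hsum
  exact h2.congr_fun fun n => by rw [mul_div_assoc]

theorem norm_besselTerm_le {y Y σ₁ σ₂ : ℝ} (hy : 0 < y) (hY : y ≤ Y) (w : ℝ) (k : ℕ) {s : ℂ}
    (h1 : σ₁ ≤ s.re - 1 / 2) (h2 : s.re - 1 / 2 ≤ σ₂) :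
    ‖besselTerm w Y s k‖ ≤ Real.exp (-(Real.pi * (k + 1) * Y)) *
      (2 * ((∫ t in Ioi 0, t ^ (σ₁ - 1) * expKernel (Real.pi / 2) (Real.pi * y ^ 2 / 2) t) +
          ∫ t in Ioi 0, t ^ (σ₂ - 1) * expKernel (Real.pi / 2) (Real.pi * y ^ 2 / 2) t)) := by
  have hπ := Real.pi_pos
  have hA : Real.pi ≤ Real.pi * ((k : ℝ) + 1) ^ 2 := by
    nlinarith [Nat.cast_nonneg (α := ℝ) k, mul_nonneg hπ.le (Nat.cast_nonneg (α := ℝ) k)]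
  have hB : Real.pi * y ^ 2 ≤ Real.pi * Y ^ 2 := by gcongr
  have hre : (s - 1 / 2).re = s.re - 1 / 2 := by simp
  have h := norm_mellin_expKernel_le_of_le hπ (by positivity : 0 < Real.pi * y ^ 2) hA hB
    (σ₁ := σ₁) (σ₂ := σ₂) (s := s - 1 / 2) (by rwa [hre]) (by rwa [hre])
  rw [sqrt_expKernel_parameters (hy.trans_le hY)] at h
  have hcos : ‖(2 : ℂ) * Real.cos (2 * Real.pi * w * (k + 1))‖ ≤ 2 := by
    rw [norm_mul, Complex.norm_real, Real.norm_eq_abs]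
    have := Real.abs_cos_le_one (2 * Real.pi * w * (k + 1))
    simp only [Complex.norm_ofNat]
    linarith
  rw [besselTerm, norm_mul]
  exact (mul_le_mul hcos h (norm_nonneg _) zero_le_two).trans_eq (by ring)

/-- Since `(m + 1)(k + 1) ≥ m + k`, a product of two geometric series dominates. -/
theorem summable_exp_neg_mul_succ_mul_succ {c : ℝ} (hc : 0 < c) :
    Summable fun p : ℕ × ℕ => Real.exp (-(c * (p.2 + 1) * (p.1 + 1))) := by
  have hg : Summable fun k : ℕ => Real.exp (-c) ^ k :=
    summable_geometric_of_lt_one (Real.exp_pos _).le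
      (by rw [← Real.exp_zero]; exact Real.exp_lt_exp.2 (by linarith))
  refine (hg.mul_of_nonneg hg (fun _ => by positivity) (fun _ => by positivity)).of_nonneg_of_le
    (fun _ => by positivity) fun p => ?_
  rw [← Real.exp_nat_mul, ← Real.exp_nat_mul, ← Real.exp_add]
  refine Real.exp_le_exp.2 ?_
  have h1 : (0 : ℝ) ≤ p.1 := Nat.cast_nonneg _
  have h2 : (0 : ℝ) ≤ p.2 := Nat.cast_nonneg _
  nlinarith [mul_nonneg (mul_nonneg hc.le h1) h2]

/-- The contribution of the nonzero Fourier coefficients to the Eisenstein series of level one. -/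
noncomputable def besselSum (z : ℍ) (s : ℂ) : ℂ :=
  ∑' p : ℕ × ℕ, besselTerm ((p.1 + 1 : ℕ) * z.re) ((p.1 + 1 : ℕ) * z.im) s p.2

theorem exists_summable_bound_besselTerm (z : ℍ) (σ₁ σ₂ : ℝ) :
    ∃ u : ℕ × ℕ → ℝ, Summable u ∧ ∀ p s, σ₁ ≤ s.re → s.re ≤ σ₂ →
      ‖besselTerm ((p.1 + 1 : ℕ) * z.re) ((p.1 + 1 : ℕ) * z.im) s p.2‖ ≤ u p := by
  refine ⟨_, (summable_exp_neg_mul_succ_mul_succ (mul_pos Real.pi_pos z.im_pos)).mul_right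
    (2 * ((∫ t in Ioi 0, t ^ ((σ₁ - 1 / 2) - 1) *
        expKernel (Real.pi / 2) (Real.pi * z.im ^ 2 / 2) t) +
      ∫ t in Ioi 0, t ^ ((σ₂ - 1 / 2) - 1) *
        expKernel (Real.pi / 2) (Real.pi * z.im ^ 2 / 2) t)), fun p s h1 h2 => ?_⟩
  refine (norm_besselTerm_le z.im_pos ?_ _ p.2 (by linarith : σ₁ - 1 / 2 ≤ s.re - 1 / 2)
    (by linarith : s.re - 1 / 2 ≤ σ₂ - 1 / 2)).trans_eq ?_
  · push_cast
    nlinarith [mul_nonneg (Nat.cast_nonneg (α := ℝ) p.1) z.im_pos.le]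
  · congr 3
    push_cast
    ring

theorem summable_besselTerm (z : ℍ) (s : ℂ) : Summable fun p : ℕ × ℕ =>
    besselTerm ((p.1 + 1 : ℕ) * z.re) ((p.1 + 1 : ℕ) * z.im) s p.2 := by
  obtain ⟨u, hu, h⟩ := exists_summable_bound_besselTerm z s.re s.re
  exact hu.of_norm_bounded fun p => h p s le_rfl le_rfl

/-- The Weierstrass test on vertical strips of width two, where one summable bound serves all `s`.
-/
theorem differentiable_besselSum (z : ℍ) : Differentiable ℂ (besselSum z) := by
  intro s₀
  obtain ⟨u, hu, h⟩ := exists_summable_bound_besselTerm z (s₀.re - 1) (s₀.re + 1)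
  set U : Set ℂ := {s | s₀.re - 1 < s.re} ∩ {s | s.re < s₀.re + 1}
  have hU : IsOpen U := (isOpen_lt continuous_const Complex.continuous_re).inter
    (isOpen_lt Complex.continuous_re continuous_const)
  have hd : ∀ p : ℕ × ℕ, DifferentiableOn ℂ (fun s =>
      besselTerm ((p.1 + 1 : ℕ) * z.re) ((p.1 + 1 : ℕ) * z.im) s p.2) U := by
    intro p
    have hπ := Real.pi_pos
    have hm : 0 < ((p.1 + 1 : ℕ) : ℝ) * z.im := by have := z.im_pos; positivity
    have hd := differentiable_mellin_expKernel
      (by positivity : 0 < Real.pi * ((p.2 : ℝ) + 1) ^ 2)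
      (by positivity : 0 < Real.pi * (((p.1 + 1 : ℕ) : ℝ) * z.im) ^ 2)
    have := hd.comp (differentiable_id.sub_const (1 / 2 : ℂ))
    exact (this.const_mul _).differentiableOn
  refine (Complex.differentiableOn_tsum_of_summable_norm hu hd hU
    (fun p s hs => h p s (le_of_lt hs.1) (le_of_lt hs.2))).differentiableAt (hU.mem_nhds ?_)
  constructor <;> simp

theorem hasSum_one_div_nat_add_one_cpow {s : ℂ} (hs : 1 < s.re) :
    HasSum (fun n : ℕ => 1 / ((n : ℂ) + 1) ^ s) (riemannZeta s) := by
  rw [zeta_eq_tsum_one_div_nat_add_one_cpow hs]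
  have h := (summable_nat_add_iff 1).2 (Complex.summable_one_div_nat_cpow.2 hs)
  refine Summable.hasSum (h.congr fun n => ?_)
  push_cast
  rfl

theorem ofReal_mul_sq_cpow {a b : ℝ} (ha : 0 ≤ a) (hb : 0 ≤ b) (s : ℂ) :
    ((a * b ^ 2 : ℝ) : ℂ) ^ s = (a : ℂ) ^ s * (b : ℂ) ^ (2 * s) := by
  rw [Complex.ofReal_mul, Complex.mul_cpow_ofReal_nonneg ha (sq_nonneg b), Complex.ofReal_pow, two_mul]
  rcases eq_or_lt_of_le hb with rfl | hb
  · rcases eq_or_ne s 0 with rfl | hs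
    · simp
    · have : s + s ≠ 0 := by rw [← two_mul]; exact mul_ne_zero two_ne_zero hs
      simp [hs, Complex.zero_cpow this]
  · rw [Complex.cpow_add _ _ (by exact_mod_cast hb.ne'), sq, Complex.mul_cpow_ofReal_nonneg hb.le hb.le]

/-- The zeroth Fourier coefficient of row `m` carries the factor `m^{1 - 2s}`, so summing over the
rows produces `ζ(2s - 1)`. -/
theorem hasSum_upper_latticeNormSq (z : ℍ) {s : ℂ} (hs : 1 < s.re) :
    HasSum (fun p : ℕ × ℤ => (Real.pi : ℂ) ^ (-s) * Complex.Gamma s *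
        (1 / (latticeNormSq z ((p.1 + 1 : ℕ), p.2) : ℂ) ^ s))
      (Complex.Gamma (s - 1 / 2) * (Real.pi * z.im ^ 2 : ℝ) ^ (1 / 2 - s) *
        riemannZeta (2 * s - 1) + besselSum z s) := by
  have hS : Summable (fun p : ℕ × ℤ => (Real.pi : ℂ) ^ (-s) * Complex.Gamma s *
        (1 / (latticeNormSq z ((p.1 + 1 : ℕ), p.2) : ℂ) ^ s)) := by
    refine Summable.mul_left _ ((summable_latticeNormSq_cpow z hs).comp_injective
      (i := fun p : ℕ × ℤ => (((p.1 + 1 : ℕ) : ℤ), p.2)) fun a b h => ?_)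
    have := Prod.ext_iff.1 h
    exact Prod.ext (by simpa using this.1) this.2
  have h1 := hS.hasSum.prod_fiberwise fun m => hasSum_int_latticeNormSq z (Nat.succ_pos m) hs
  have h2 := (summable_besselTerm z s).hasSum.prod_fiberwise
    fun m => ((summable_besselTerm z s).prod_factor m).hasSum
  have hre : 1 < (2 * s - 1).re := by simp; linarith
  have h3 := (hasSum_one_div_nat_add_one_cpow hre).mul_left
    (Complex.Gamma (s - 1 / 2) * (Real.pi * z.im ^ 2 : ℝ) ^ (1 / 2 - s))
  have h4 := h1.unique ((h3.add h2).congr_fun fun m => by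
    congr 1
    have e : ((Real.pi * ((m.succ : ℕ) * z.im) ^ 2 : ℝ) : ℂ) =
        ((Real.pi * z.im ^ 2 * ((m.succ : ℕ) : ℝ) ^ 2 : ℝ) : ℂ) := by
      congr 1; ring
    have hπ := Real.pi_pos
    rw [e, ofReal_mul_sq_cpow (by positivity) (by positivity), mul_assoc]
    congr 2
    rw [show 2 * (1 / 2 - s) = -(2 * s - 1) by ring, Complex.cpow_neg, one_div]
    push_cast
    rfl)
  rw [besselSum, ← h4]
  exact hS.hasSum

/-! ### From nonzero pairs to primitive pairs -/

/-- The pairs `(m, n)` with `m > 0`, or `m = 0` and `n > 0`: representatives of the nonzero pairs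
up to sign. -/
def posPairs : Set (ℤ × ℤ) := {x | 0 < x.1 ∨ x.1 = 0 ∧ 0 < x.2}

/-- The positive pairs with first entry zero, respectively nonzero. -/
def posPairsEquiv : ℕ ⊕ (ℕ × ℤ) ≃ posPairs where
  toFun := Sum.elim (fun n => ⟨(0, (n + 1 : ℕ)), Or.inr ⟨rfl, by positivity⟩⟩)
    (fun p => ⟨((p.1 + 1 : ℕ), p.2), Or.inl (by positivity)⟩)
  invFun x := if x.1.1 = 0 then Sum.inl (x.1.2 - 1).toNat else Sum.inr ((x.1.1 - 1).toNat, x.1.2)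
  left_inv := by
    rintro (n | ⟨m, n⟩)
    · simp
    · have : ((m : ℤ) + 1) ≠ 0 := by omega
      simp [this]
  right_inv := by
    rintro ⟨⟨m, n⟩, h⟩
    simp only [posPairs, mem_ofPred_eq] at h
    by_cases hm : m = 0
    · subst hm
      have h1 : 0 < n := by simpa using h
      refine Subtype.ext (Prod.ext ?_ ?_) <;> simp
      omega
    · have h1 : 0 < m := by tauto
      refine Subtype.ext (Prod.ext ?_ ?_) <;> simp [hm]
      omega

/-- The completed part of the Eisenstein series of level one. -/
noncomputable def eisensteinTail (z : ℍ) (s : ℂ) : ℂ :=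
  (Real.pi : ℂ) ^ s * (Complex.Gamma (s - 1 / 2) * (Real.pi * z.im ^ 2 : ℝ) ^ (1 / 2 - s) *
        riemannZeta (2 * s - 1) + besselSum z s)

theorem hasSum_posPairs (z : ℍ) {s : ℂ} (hs : 1 < s.re) :
    HasSum (fun x : posPairs => 1 / (latticeNormSq z x : ℂ) ^ s)
      (riemannZeta (2 * s) + eisensteinTail z s / Complex.Gamma s) := by
  rw [← posPairsEquiv.hasSum_iff]
  refine HasSum.sum ?_ ?_
  · have hre : 1 < (2 * s).re := by simp; linarith
    refine (hasSum_one_div_nat_add_one_cpow hre).congr_fun fun n => ?_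
    have : latticeNormSq z (0, ((n + 1 : ℕ) : ℤ)) = 1 * ((n : ℝ) + 1) ^ 2 := by
      rw [latticeNormSq_eq]; push_cast; ring
    simp only [posPairsEquiv, Function.comp_apply, Equiv.coe_fn_mk, Sum.elim_inl]
    rw [this, ofReal_mul_sq_cpow zero_le_one (by positivity)]
    simp
  · have hG := Complex.Gamma_ne_zero_of_re_pos (show 0 < s.re by linarith)
    have hπ : (Real.pi : ℂ) ≠ 0 := by exact_mod_cast Real.pi_ne_zero
    have h := (hasSum_upper_latticeNormSq z hs).mul_left ((Real.pi : ℂ) ^ s / Complex.Gamma s)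
    have e : (Real.pi : ℂ) ^ s / Complex.Gamma s * (Complex.Gamma (s - 1 / 2) *
        (Real.pi * z.im ^ 2 : ℝ) ^ (1 / 2 - s) * riemannZeta (2 * s - 1) + besselSum z s) =
        eisensteinTail z s / Complex.Gamma s := by
      rw [eisensteinTail]; ring
    rw [e] at h
    refine h.congr_fun fun p => ?_
    simp only [posPairsEquiv, Function.comp_apply, Equiv.coe_fn_mk, Sum.elim_inr]
    rw [Complex.cpow_neg]
    have := (Complex.cpow_ne_zero_iff (x := (Real.pi : ℂ)) (y := s)).2 (Or.inl hπ)
    field_simp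

/-- The positive coprime pairs. -/
def primPairs : Set (ℤ × ℤ) := {x | x ∈ posPairs ∧ IsCoprime x.1 x.2}

theorem gcd_pos_of_mem_posPairs {x : ℤ × ℤ} (hx : x ∈ posPairs) : 0 < Int.gcd x.1 x.2 := by
  rcases hx with h | h
  · exact Int.gcd_pos_of_ne_zero_left _ h.ne'
  · exact Int.gcd_pos_of_ne_zero_right _ h.2.ne'

/-- The multiple `(t + 1) x` of a primitive pair `x`. -/
def scalePrimPair (p : ℕ × primPairs) : posPairs :=
  ⟨(((p.1 + 1 : ℕ) : ℤ) * p.2.1.1, ((p.1 + 1 : ℕ) : ℤ) * p.2.1.2), by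
    have h := p.2.2.1
    simp only [posPairs, mem_ofPred_eq] at h ⊢
    rcases h with h | h
    · left; positivity
    · right; rw [h.1, mul_zero]; exact ⟨rfl, by have := h.2; positivity⟩⟩

/-- A nonzero pair is its gcd times a primitive pair, in one way only. -/
theorem scalePrimPair_bijective : Function.Bijective scalePrimPair := by
  constructor
  · rintro ⟨s, ⟨⟨a, b⟩, hab, hc⟩⟩ ⟨t, ⟨⟨c, d⟩, hcd, hc'⟩⟩ h
    simp only [scalePrimPair, Subtype.mk.injEq, Prod.mk.injEq] at h
    have hg : s + 1 = t + 1 := by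
      have h1 := Int.gcd_mul_left ((s + 1 : ℕ) : ℤ) a b
      have h2 := Int.gcd_mul_left ((t + 1 : ℕ) : ℤ) c d
      rw [h.1, h.2, h2, Int.isCoprime_iff_gcd_eq_one.1 hc, Int.isCoprime_iff_gcd_eq_one.1 hc'] at h1
      simp only [mul_one, Int.natAbs_natCast] at h1
      exact h1.symm
    have hst : s = t := by omega
    subst hst
    have h0 : ((s + 1 : ℕ) : ℤ) ≠ 0 := by omega
    have ha := mul_left_cancel₀ h0 h.1
    have hb := mul_left_cancel₀ h0 h.2
    subst ha hb
    rfl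
  · rintro ⟨⟨a, b⟩, h⟩
    have hg := gcd_pos_of_mem_posPairs h
    obtain ⟨a', b', hc, ha, hb⟩ := Int.exists_gcd_one hg
    simp only at ha hb hg
    generalize Int.gcd a b = g at ha hb hg
    refine ⟨⟨g - 1, ⟨(a', b'), ?_, Int.isCoprime_iff_gcd_eq_one.2 hc⟩⟩, ?_⟩
    · have hg' : (0 : ℤ) < g := by exact_mod_cast hg
      simp only [posPairs, mem_ofPred_eq] at h ⊢
      rw [ha, hb] at h
      rcases h with h | h
      · left; exact pos_of_mul_pos_left h hg'.le
      · right
        exact ⟨(mul_eq_zero.1 h.1).resolve_right hg'.ne', pos_of_mul_pos_left h.2 hg'.le⟩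
    · simp only [scalePrimPair, Subtype.mk.injEq, Prod.mk.injEq, Nat.sub_add_cancel hg]
      constructor
      · rw [mul_comm]; exact ha.symm
      · rw [mul_comm]; exact hb.symm

theorem latticeNormSq_scalePrimPair (z : ℍ) (p : ℕ × primPairs) :
    latticeNormSq z (scalePrimPair p) = latticeNormSq z p.2 * ((p.1 : ℝ) + 1) ^ 2 := by
  rw [latticeNormSq_eq, latticeNormSq_eq]
  simp only [scalePrimPair]
  push_cast
  ring

/-- The function `s ↦ y^s (1 + ⋯)` continuing the Eisenstein series of level one. -/
noncomputable def levelOneEisenstein (z : ℍ) (s : ℂ) : ℂ :=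
  (z.im : ℂ) ^ s * (1 + eisensteinTail z s / (Complex.Gamma s * riemannZeta (2 * s)))

theorem hasSum_mul_of_summable_norm {ι κ : Type*} {f : ι → ℂ} {g : κ → ℂ} {a b : ℂ}
    (hf : HasSum f a) (hg : HasSum g b) (hf' : Summable fun i => ‖f i‖)
    (hg' : Summable fun i => ‖g i‖) : HasSum (fun p : ι × κ => f p.1 * g p.2) (a * b) :=
  hf.mul hg (summable_mul_of_summable_norm hf' hg')

/-- Factoring out the gcd makes the sum over all positive pairs `ζ(2s)` times the primitive one, and
`ζ(2s) ≠ 0` for `Re s > 1`. -/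
theorem hasSum_primPairs (z : ℍ) {s : ℂ} (hs : 1 < s.re) :
    HasSum (fun x : primPairs => ((z.im / latticeNormSq z x : ℝ) : ℂ) ^ s)
      (levelOneEisenstein z s) := by
  have hre : 1 < (2 * s).re := by simp; linarith
  have hζ : riemannZeta (2 * s) ≠ 0 := riemannZeta_ne_zero_of_one_le_re hre.le
  have hG := Complex.Gamma_ne_zero_of_re_pos (show 0 < s.re by linarith)
  have hS : Summable (fun x : primPairs => 1 / (latticeNormSq z x : ℂ) ^ s) :=
    (summable_latticeNormSq_cpow z hs).comp_injective Subtype.val_injective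
  have hN := hasSum_one_div_nat_add_one_cpow hre
  have hN' := hN.summable.norm
  have hprod := hasSum_mul_of_summable_norm hN hS.hasSum hN' hS.norm
  have h1 := (Equiv.ofBijective _ scalePrimPair_bijective).hasSum_iff.2 (hasSum_posPairs z hs)
  have h2 : HasSum ((fun x : posPairs => 1 / (latticeNormSq z x : ℂ) ^ s) ∘ scalePrimPair)
      (riemannZeta (2 * s) * ∑' x : primPairs, 1 / (latticeNormSq z x : ℂ) ^ s) := by
    refine hprod.congr_fun fun p => ?_
    rw [Function.comp_apply, latticeNormSq_scalePrimPair,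
      ofReal_mul_sq_cpow (latticeNormSq_nonneg z _) (by positivity)]
    push_cast
    rw [one_div_mul_one_div_rev]
  have h3 := h2.unique h1
  have h4 : ∑' x : primPairs, 1 / (latticeNormSq z x : ℂ) ^ s =
      1 + eisensteinTail z s / (Complex.Gamma s * riemannZeta (2 * s)) := by
    field_simp at h3 ⊢
    linear_combination h3
  have h5 := hS.hasSum.mul_left ((z.im : ℂ) ^ s)
  rw [h4] at h5
  refine h5.congr_fun fun x => ?_
  have h0 := latticeNormSq_nonneg z x
  rw [div_eq_mul_inv, Complex.ofReal_mul, Complex.mul_cpow_ofReal_nonneg z.im_pos.le (inv_nonneg.2 h0),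
    Complex.ofReal_inv, Complex.inv_cpow, one_div]
  rw [Complex.arg_ofReal_of_nonneg h0]
  exact Real.pi_pos.ne

/-! ### Divisor sums for squarefree `N` -/

theorem Nat.Coprime.sum_divisors_mul_eq {M : Type*} [AddCommMonoid M] {m n : ℕ}
    (hmn : m.Coprime n) (F : ℕ → M) :
    ∑ v ∈ (m * n).divisors, F v = ∑ h ∈ m.divisors, ∑ g ∈ n.divisors, F (h * g) := by
  rw [Nat.divisors_mul, ← Finset.image_mul_product, Finset.sum_image, Finset.sum_product]
  exact hmn.mul_injOn_divisors

theorem coprime_div_gcd_of_squarefree {N : ℕ} (hN : Squarefree N) (c : ℕ) :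
    (N / N.gcd c).Coprime c := by
  have hN0 : 0 < N := Nat.pos_of_ne_zero hN.ne_zero
  have hM : 0 < N.gcd c := Nat.gcd_pos_of_pos_left _ hN0
  have h1 : (N / N.gcd c).Coprime (N.gcd c) := by
    refine Nat.coprime_of_squarefree_mul ?_
    rwa [Nat.div_mul_cancel (Nat.gcd_dvd_left _ _)]
  have h2 := Nat.coprime_div_gcd_div_gcd hM
  have h3 := Nat.Coprime.mul_right h1 h2
  rwa [Nat.mul_div_cancel' (Nat.gcd_dvd_right _ _)] at h3

/-- Write `N = M K` with `M = gcd(N, c)`; then `K` is coprime to `c`. For `v = h (K / g)` with `h ∣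
M`, `g ∣ K`, the gcd of `v` and `c` is `h`, so the argument is `h g / K = h g (M / N)`, and `u = h
g` runs over the divisors of `N`. -/
theorem sum_divisors_gcd_sq_div {N : ℕ} (hN : Squarefree N) (c : ℕ) (F : ℝ → ℂ) :
    ∑ v ∈ N.divisors, F ((v.gcd c : ℝ) ^ 2 / v) =
      ∑ u ∈ N.divisors, F (u * (N.gcd c / N : ℝ)) := by
  have hN0 : 0 < N := Nat.pos_of_ne_zero hN.ne_zero
  have hcop := coprime_div_gcd_of_squarefree hN c
  obtain ⟨K, hK⟩ := Nat.gcd_dvd_left N c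
  have hMc := Nat.gcd_dvd_right N c
  generalize hM : N.gcd c = M at *
  subst hK
  have hM0 : 0 < M := Nat.pos_of_mul_pos_right hN0
  have hK0 : 0 < K := Nat.pos_of_mul_pos_left hN0
  rw [Nat.mul_div_cancel_left _ hM0] at hcop
  have hMK : M.Coprime K := hcop.symm.coprime_dvd_left hMc
  rw [hMK.sum_divisors_mul_eq, hMK.sum_divisors_mul_eq]
  refine Finset.sum_congr rfl fun h hh => ?_
  rw [← Nat.sum_div_divisors]
  refine Finset.sum_congr rfl fun g hg => ?_
  have hhM := Nat.dvd_of_mem_divisors hh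
  have hgK := Nat.dvd_of_mem_divisors hg
  have hgcd : (h * (K / g)).gcd c = h := by
    rw [Nat.Coprime.gcd_mul_right_cancel h (hcop.coprime_dvd_left (Nat.div_dvd_of_dvd hgK))]
    exact Nat.gcd_eq_left (hhM.trans hMc)
  have hh0 : (h : ℝ) ≠ 0 := by exact_mod_cast (Nat.pos_of_dvd_of_pos hhM hM0).ne'
  have hg0 : (g : ℝ) ≠ 0 := by exact_mod_cast (Nat.pos_of_dvd_of_pos hgK hK0).ne'
  have hM0' : (M : ℝ) ≠ 0 := by exact_mod_cast hM0.ne'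
  have hK0' : (K : ℝ) ≠ 0 := by exact_mod_cast hK0.ne'
  rw [hgcd]
  congr 1
  rw [Nat.cast_mul, Nat.cast_div hgK hg0]
  push_cast
  field_simp

/-- The sum is the product of `1 + p^s` over the primes `p ∣ N`, and `|p^s| = p^{Re s} > 1` excludes
`p^s = -1`. -/
theorem sum_divisors_cpow_ne_zero {N : ℕ} (hN : Squarefree N) {s : ℂ} (hs : 0 < s.re) :
    ∑ v ∈ N.divisors, (v : ℂ) ^ s ≠ 0 := by
  let f : ArithmeticFunction ℂ := ⟨fun n => if n = 0 then 0 else (n : ℂ) ^ s, by simp⟩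
  have hf : ∀ n, n ≠ 0 → f n = (n : ℂ) ^ s := fun n hn => by simp [f, hn]
  have hmul : f.IsMultiplicative := by
    rw [ArithmeticFunction.IsMultiplicative.iff_ne_zero]
    refine ⟨by simp [hf 1 one_ne_zero], fun {m n} hm hn _ => ?_⟩
    rw [hf _ (mul_ne_zero hm hn), hf _ hm, hf _ hn, Nat.cast_mul, Complex.natCast_mul_natCast_cpow]
  have h := hmul.prodPrimeFactors_one_add_of_squarefree hN
  rw [Finset.sum_congr rfl fun v hv => (hf v (Nat.pos_of_mem_divisors hv).ne').symm, ← h]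
  refine Finset.prod_ne_zero_iff.2 fun p hp h0 => ?_
  have hpp := Nat.prime_of_mem_primeFactors hp
  rw [hf p hpp.ne_zero] at h0
  have h1 : (p : ℂ) ^ s = -1 := by linear_combination h0
  have h2 := Complex.norm_natCast_cpow_of_pos hpp.pos s
  rw [h1, norm_neg, norm_one] at h2
  have := Real.one_lt_rpow (show (1 : ℝ) < p by exact_mod_cast hpp.one_lt) hs
  linarith

/-! ### Dilation `z ↦ v z` as a permutation of primitive pairs -/

/-- This makes the dilation of pairs invertible: the gcd of `v` with the new second entry is the
complementary divisor `v / gcd(v, a)`, so the original gcd can be recovered. -/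
theorem Int.gcd_mul_div_gcd {v : ℕ} (hv : 0 < v) {a b : ℤ} (hab : IsCoprime a b) :
    Int.gcd v (b * (v / Int.gcd v a)) = v / Int.gcd v a := by
  obtain ⟨k, hk⟩ : (Int.gcd v a) ∣ v := by
    have := Int.gcd_dvd_left (a := (v : ℤ)) (b := a)
    exact_mod_cast this
  have hg : 0 < Int.gcd v a := Int.gcd_pos_of_ne_zero_left _ (by exact_mod_cast hv.ne')
  have hga := Int.gcd_dvd_right (a := (v : ℤ)) (b := a)
  generalize Int.gcd v a = g at *
  subst hk
  have hgb : Int.gcd g b = 1 := Int.isCoprime_iff_gcd_eq_one.1 (hab.of_isCoprime_of_dvd_left hga)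
  have e : ((g * k : ℕ) : ℤ) / g = k := by
    push_cast
    exact Int.mul_ediv_cancel_left _ (by exact_mod_cast hg.ne')
  rw [e, Nat.mul_div_cancel_left _ hg, Nat.cast_mul, Int.gcd_mul_right, hgb]
  simp

theorem Int.isCoprime_div_gcd_mul_div_gcd {v : ℕ} (hv : 0 < v) {a b : ℤ} (hab : IsCoprime a b) :
    IsCoprime (a / Int.gcd v a) (b * (v / Int.gcd v a)) := by
  have hg : 0 < Int.gcd v a := Int.gcd_pos_of_ne_zero_left _ (by exact_mod_cast hv.ne')
  refine IsCoprime.mul_right (hab.of_isCoprime_of_dvd_left ?_) ?_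
  · exact Int.ediv_dvd_of_dvd (Int.gcd_dvd_right _ _)
  · exact (Int.isCoprime_iff_gcd_eq_one.2 (Int.gcd_ediv_gcd_ediv_gcd hg)).symm

theorem Int.div_gcd_pos {v : ℕ} (hv : 0 < v) (a : ℤ) : (0 : ℤ) < v / Int.gcd v a :=
  Int.ediv_pos_of_pos_of_dvd (by exact_mod_cast hv) (by positivity) (Int.gcd_dvd_left _ _)

theorem Int.div_div_gcd {v : ℕ} (hv : 0 < v) (a : ℤ) :
    (v : ℤ) / ((v / Int.gcd v a : ℕ) : ℤ) = Int.gcd v a := by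
  have h : (Int.gcd v a) ∣ v := by
    have := Int.gcd_dvd_left (a := (v : ℤ)) (b := a)
    exact_mod_cast this
  rw [← Int.natCast_div, Nat.div_div_self h hv.ne']

theorem mul_pos_mem_posPairs {x : ℤ × ℤ} (hx : x ∈ posPairs) {a b k l : ℤ} (hk : 0 < k)
    (hl : 0 < l) (ha : a * k = x.1 * l) (hb : ∃ i j : ℤ, 0 < i ∧ 0 < j ∧ b * i = x.2 * j) :
    (a, b) ∈ posPairs := by
  obtain ⟨i, j, hi, hj, hb⟩ := hb
  rcases hx with h | h
  · left
    exact pos_of_mul_pos_left (ha ▸ mul_pos h hl) hk.le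
  · right
    rw [h.1, zero_mul] at ha
    exact ⟨(mul_eq_zero.1 ha).resolve_right hk.ne', pos_of_mul_pos_left (hb ▸ mul_pos h.2 hj) hi.le⟩

/-- The permutation `(C, D) ↦ (C / h, D v / h)`, `h = gcd (v, C)`, of the primitive pairs: it sends
a primitive pair to the primitive multiple of `(C / v, D)`. -/
def primPairsDilate (v : ℕ) (hv : 0 < v) : primPairs ≃ primPairs where
  toFun x := ⟨(x.1.1 / Int.gcd v x.1.1, x.1.2 * (v / Int.gcd v x.1.1)), by
    have hg : 0 < Int.gcd v x.1.1 := Int.gcd_pos_of_ne_zero_left _ (by exact_mod_cast hv.ne')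
    refine ⟨mul_pos_mem_posPairs x.2.1 (k := Int.gcd v x.1.1) (l := 1) (by exact_mod_cast hg)
      one_pos ?_ ⟨1, _, one_pos, Int.div_gcd_pos hv x.1.1, mul_one _⟩,
      Int.isCoprime_div_gcd_mul_div_gcd hv x.2.2⟩
    rw [mul_one, Int.ediv_mul_cancel (Int.gcd_dvd_right _ _)]⟩
  invFun x := ⟨(x.1.1 * (v / Int.gcd v x.1.2), x.1.2 / Int.gcd v x.1.2), by
    have hg : 0 < Int.gcd v x.1.2 := Int.gcd_pos_of_ne_zero_left _ (by exact_mod_cast hv.ne')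
    refine ⟨mul_pos_mem_posPairs x.2.1 (k := 1) one_pos (Int.div_gcd_pos hv x.1.2) (mul_one _)
      ⟨Int.gcd v x.1.2, 1, by exact_mod_cast hg, one_pos, ?_⟩,
      (Int.isCoprime_div_gcd_mul_div_gcd hv x.2.2.symm).symm⟩
    rw [mul_one, Int.ediv_mul_cancel (Int.gcd_dvd_right _ _)]⟩
  left_inv x := by
    have h := Int.gcd_mul_div_gcd hv x.2.2
    refine Subtype.ext (Prod.ext ?_ ?_)
    · simp only [h, Int.div_div_gcd hv]
      exact Int.ediv_mul_cancel (Int.gcd_dvd_right _ _)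
    · simp only [h, Int.natCast_div]
      exact Int.mul_ediv_cancel _ (Int.div_gcd_pos hv x.1.1).ne'
  right_inv x := by
    have h := Int.gcd_mul_div_gcd hv x.2.2.symm
    refine Subtype.ext (Prod.ext ?_ ?_)
    · simp only [h, Int.natCast_div]
      exact Int.mul_ediv_cancel _ (Int.div_gcd_pos hv x.1.2).ne'
    · simp only [h, Int.div_div_gcd hv]
      exact Int.ediv_mul_cancel (Int.gcd_dvd_right _ _)

/-- The point `v z` for a positive integer `v`. -/
noncomputable def natDilate (v : ℕ) (z : ℍ) : ℍ :=
  if h : 0 < v then ⟨(v : ℂ) * z, by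
    have := z.im_pos
    have hv : (0 : ℝ) < v := by exact_mod_cast h
    simp
    positivity⟩ else z

theorem coe_natDilate {v : ℕ} (hv : 0 < v) (z : ℍ) : (natDilate v z : ℂ) = v * z := by
  simp [natDilate, hv]

theorem natDilate_im {v : ℕ} (hv : 0 < v) (z : ℍ) : (natDilate v z).im = v * z.im := by
  rw [← UpperHalfPlane.coe_im, coe_natDilate hv]
  simp

/-- With `g = gcd(v, C)`, the new pair satisfies `(C / g) v z + D v / g = (v / g)(C z + D)`. -/
theorem im_div_latticeNormSq_dilate {v : ℕ} (hv : 0 < v) (z : ℍ) (x : primPairs) :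
    (natDilate v z).im / latticeNormSq (natDilate v z) (primPairsDilate v hv x) =
      (v.gcd x.1.1.natAbs : ℝ) ^ 2 / v * (z.im / latticeNormSq z x) := by
  have hre : (natDilate v z).re = v * z.re := by
    rw [← UpperHalfPlane.coe_re, coe_natDilate hv]
    simp
  have hgcd : v.gcd x.1.1.natAbs = Int.gcd v x.1.1 := by simp [Int.gcd]
  have hx := latticeNormSq_pos z (x := x.1) (by
    rintro h
    have := x.2.1
    rw [h] at this
    simp [posPairs] at this)
  have hg : 0 < Int.gcd v x.1.1 := Int.gcd_pos_of_ne_zero_left _ (by exact_mod_cast hv.ne')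
  obtain ⟨k, hk⟩ := Int.gcd_dvd_left (a := (v : ℤ)) (b := x.1.1)
  obtain ⟨l, hl⟩ := Int.gcd_dvd_right (a := (v : ℤ)) (b := x.1.1)
  have key : latticeNormSq (natDilate v z) (primPairsDilate v hv x) * (Int.gcd v x.1.1 : ℝ) ^ 2 =
      v ^ 2 * latticeNormSq z x := by
    rw [latticeNormSq_eq, latticeNormSq_eq, natDilate_im hv, hre]
    simp only [primPairsDilate, Equiv.coe_fn_mk]
    generalize Int.gcd v x.1.1 = g at *
    have hg' : (g : ℤ) ≠ 0 := by exact_mod_cast hg.ne'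
    have e1 : x.1.1 / (g : ℤ) = l := by rw [hl]; exact Int.mul_ediv_cancel_left _ hg'
    have e2 : (v : ℤ) / (g : ℤ) = k := by rw [hk]; exact Int.mul_ediv_cancel_left _ hg'
    have hkR : (v : ℝ) = g * k := by exact_mod_cast hk
    have hlR : ((x.1.1 : ℤ) : ℝ) = g * l := by exact_mod_cast hl
    rw [e1, e2, hlR, hkR]
    push_cast
    ring
  have hgR : (Int.gcd v x.1.1 : ℝ) ≠ 0 := by exact_mod_cast hg.ne'
  have hvR : (v : ℝ) ≠ 0 := by exact_mod_cast hv.ne'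
  have hne : latticeNormSq (natDilate v z) (primPairsDilate v hv x) ≠ 0 := by
    intro h0
    rw [h0, zero_mul] at key
    have : (v : ℝ) ^ 2 * latticeNormSq z x ≠ 0 := mul_ne_zero (pow_ne_zero 2 hvR) hx.ne'
    exact this key.symm
  rw [hgcd, natDilate_im hv]
  field_simp
  linear_combination -key

theorem hasSum_primPairs_gcd {N : ℕ} (hN : Squarefree N) (z : ℍ) {s : ℂ} (hs : 1 < s.re) :
    HasSum (fun x : primPairs =>
        ((N.gcd x.1.1.natAbs / N * (z.im / latticeNormSq z x) : ℝ) : ℂ) ^ s)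
      ((∑ v ∈ N.divisors, levelOneEisenstein (natDilate v z) s) /
        ∑ v ∈ N.divisors, (v : ℂ) ^ s) := by
  have hσ := sum_divisors_cpow_ne_zero hN (show 0 < s.re by linarith)
  have h1 : ∀ v ∈ N.divisors, HasSum (fun x : primPairs =>
      (((v.gcd x.1.1.natAbs : ℝ) ^ 2 / v * (z.im / latticeNormSq z x) : ℝ) : ℂ) ^ s)
      (levelOneEisenstein (natDilate v z) s) := by
    intro v hv
    have hv0 := Nat.pos_of_mem_divisors hv
    refine ((primPairsDilate v hv0).hasSum_iff.2
      (hasSum_primPairs (natDilate v z) hs)).congr_fun fun x => ?_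
    rw [Function.comp_apply, im_div_latticeNormSq_dilate hv0]
  refine ((hasSum_sum h1).div_const _).congr_fun fun x => ?_
  rw [eq_div_iff hσ, sum_divisors_gcd_sq_div hN x.1.1.natAbs
    (fun t => ((t * (z.im / latticeNormSq z x) : ℝ) : ℂ) ^ s), Finset.mul_sum]
  refine Finset.sum_congr rfl fun u _ => ?_
  have h0 : 0 ≤ N.gcd x.1.1.natAbs / N * (z.im / latticeNormSq z x) := by
    have := latticeNormSq_nonneg z x
    have := z.im_pos
    positivity
  rw [mul_assoc, Complex.ofReal_mul (u : ℝ), Complex.mul_cpow_ofReal_nonneg (Nat.cast_nonneg u) h0,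
    mul_comm, Complex.ofReal_natCast]

/-! ### Cosets of `Γ_∞(N)` as primitive pairs -/

theorem moonshineGroup_lower_left_mul_inv (γ δ : SL(2, ℝ)) :
    (γ * δ⁻¹) 1 0 = γ 1 0 * δ 1 1 - γ 1 1 * δ 1 0 := by
  simp [Matrix.SpecialLinearGroup.coe_mul, Matrix.SpecialLinearGroup.coe_inv,
    Matrix.adjugate_fin_two, Matrix.mul_apply, Fin.sum_univ_two]
  ring

theorem mk_eq_mk_parabolicCosets_iff {N : ℕ} (γ δ : moonshineGroup N) :
    (Quotient.mk'' γ : ParabolicCosets N) = Quotient.mk'' δ ↔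
      (δ : SL(2, ℝ)) 1 0 * (γ : SL(2, ℝ)) 1 1 = (δ : SL(2, ℝ)) 1 1 * (γ : SL(2, ℝ)) 1 0 := by
  rw [Quotient.eq'', QuotientGroup.rightRel_apply]
  change ((δ : SL(2, ℝ)) * (γ : SL(2, ℝ))⁻¹) 1 0 = 0 ↔ _
  rw [moonshineGroup_lower_left_mul_inv, sub_eq_zero]

/-- For `e = N / gcd(N, C)`, squarefreeness makes `e` coprime to `C`, so `e D` and `C` are coprime
and a Bézout relation fills in the upper row. The product `e C` is divisible by `N` because `gcd(N,
C) ∣ C`. -/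
theorem exists_moonshineGroup_of_coprime {N : ℕ} (hN : Squarefree N) {C D : ℤ}
    (h : IsCoprime C D) : ∃ γ : moonshineGroup N,
      (γ : SL(2, ℝ)) 1 0 = √((N / N.gcd C.natAbs : ℕ) : ℝ) * C ∧
      (γ : SL(2, ℝ)) 1 1 = √((N / N.gcd C.natAbs : ℕ) : ℝ) * D := by
  have hN0 : 0 < N := Nat.pos_of_ne_zero hN.ne_zero
  have hcop := coprime_div_gcd_of_squarefree hN C.natAbs
  have hdvd := Nat.gcd_dvd_left N C.natAbs
  have hM0 := Nat.gcd_pos_of_pos_left C.natAbs hN0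
  have he0 : 0 < N / N.gcd C.natAbs := Nat.div_pos (Nat.le_of_dvd hN0 hdvd) hM0
  have hMe : N.gcd C.natAbs * (N / N.gcd C.natAbs) = N := Nat.mul_div_cancel' hdvd
  have hMC : ((N.gcd C.natAbs : ℕ) : ℤ) ∣ C := Int.natCast_dvd.2 (Nat.gcd_dvd_right _ _)
  generalize N / N.gcd C.natAbs = e at *
  generalize N.gcd C.natAbs = M at *
  have hcop' : IsCoprime (e : ℤ) C := by
    rw [Int.isCoprime_iff_gcd_eq_one, Int.gcd, Int.natAbs_natCast]
    exact hcop
  obtain ⟨u, w, huw⟩ := hcop'.mul_left h.symm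
  have heR : (0 : ℝ) < e := by exact_mod_cast he0
  have hs : √(e : ℝ) ≠ 0 := (Real.sqrt_pos.2 heR).ne'
  have hsq : √(e : ℝ) * √(e : ℝ) = e := Real.mul_self_sqrt heR.le
  have huwR : (u : ℝ) * (e * D) + w * C = 1 := by exact_mod_cast huw
  refine ⟨⟨⟨(1 / √(((e : ℕ) : ℤ) : ℝ)) •
    !![((e * u : ℤ) : ℝ), ((-w : ℤ) : ℝ); ((e * C : ℤ) : ℝ), ((e * D : ℤ) : ℝ)], ?_⟩,
    ⟨e * u, -w, e * C, e * D, e, by exact_mod_cast he0, ?_, ?_, Dvd.intro _ rfl, Dvd.intro _ rfl,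
      ?_, rfl⟩⟩, ?_, ?_⟩
  · rw [Matrix.det_smul, Matrix.det_fin_two_of]
    simp only [Fintype.card_fin, Int.cast_natCast, Int.cast_mul, Int.cast_neg]
    rw [div_pow, Real.sq_sqrt heR.le]
    field_simp
    linear_combination huwR
  · linear_combination (e : ℤ) * huw
  · exact Int.natCast_dvd_natCast.2 ⟨M, by rw [mul_comm]; exact hMe.symm⟩
  · obtain ⟨k, hk⟩ := hMC
    refine ⟨k, ?_⟩
    rw [hk, ← hMe]
    push_cast
    ring
  · simp
    field_simp
    rw [sq, hsq]
  · simp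
    field_simp
    rw [sq, hsq]

/-- Put `N = e v`, `c = N χ`, `d = e δ`: the lower row is `√e (v χ, δ)`. Dividing the determinant
equation by `e` shows that `v χ` and `δ` are coprime and that `e` is coprime to `χ`, so `gcd(N, v χ)
= v`. -/
theorem exists_coprime_of_moonshineGroup {N : ℕ} (hN : Squarefree N) (γ : moonshineGroup N) :
    ∃ C D : ℤ, IsCoprime C D ∧
      (γ : SL(2, ℝ)) 1 0 = √((N / N.gcd C.natAbs : ℕ) : ℝ) * C ∧
      (γ : SL(2, ℝ)) 1 1 = √((N / N.gcd C.natAbs : ℕ) : ℝ) * D := by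
  obtain ⟨γ, a, b, c, d, e, he, hdet, ⟨v, hv⟩, ⟨α, rfl⟩, ⟨δ, rfl⟩, ⟨χ, rfl⟩, hγ⟩ := γ
  have hN0 : (0 : ℤ) < N := by exact_mod_cast Nat.pos_of_ne_zero hN.ne_zero
  have hv0 : 0 < v := pos_of_mul_pos_right (hv ▸ hN0) he.le
  lift e to ℕ using he.le
  lift v to ℕ using hv0.le
  have hNev : N = e * v := by exact_mod_cast hv
  have he0 : 0 < e := by exact_mod_cast he
  have h1 : α * (e * δ) - b * (v * χ) = 1 := by
    apply mul_left_cancel₀ he.ne'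
    rw [hv] at hdet
    linear_combination hdet
  have hgcd : N.gcd ((v : ℤ) * χ).natAbs = v := by
    have h2 : IsCoprime (e : ℤ) χ := ⟨α * δ, -(b * v), by linear_combination h1⟩
    rw [Int.isCoprime_iff_gcd_eq_one, Int.gcd, Int.natAbs_natCast] at h2
    rw [Int.natAbs_mul, Int.natAbs_natCast, hNev, mul_comm e v, Nat.gcd_mul_left, h2, mul_one]
  have heR : (0 : ℝ) < e := by exact_mod_cast he0
  have hs : √(e : ℝ) ≠ 0 := (Real.sqrt_pos.2 heR).ne'
  have hsq : √(e : ℝ) * √(e : ℝ) = e := Real.mul_self_sqrt heR.le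
  have hNR : (N : ℝ) = e * v := by exact_mod_cast hNev
  have hdiv : N / v = e := by rw [hNev]; exact Nat.mul_div_cancel _ (by exact_mod_cast hv0)
  refine ⟨v * χ, δ, ⟨-b, α * e, by linear_combination h1⟩, ?_, ?_⟩
  · rw [hgcd, hdiv]
    simp only [hγ]
    simp [hNR]
    field_simp
    rw [sq, hsq]
  · rw [hgcd, hdiv]
    simp only [hγ]
    simp
    field_simp
    rw [sq, hsq]

/-- A chosen element of `Γ₀(N)⁺` whose lower row is proportional to a given primitive pair. -/
noncomputable def primPairLift {N : ℕ} (hN : Squarefree N) (x : primPairs) : moonshineGroup N :=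
  (exists_moonshineGroup_of_coprime hN x.2.2).choose

/-- Proportional primitive pairs agree up to sign, and the positivity condition fixes the sign. -/
theorem primPairs_ext {x x' : primPairs} (h : x.1.1 * x'.1.2 = x.1.2 * x'.1.1) : x = x' := by
  obtain ⟨⟨C, D⟩, hx, hc⟩ := x
  obtain ⟨⟨C', D'⟩, hx', hc'⟩ := x'
  simp only at h hc hc'
  simp only [posPairs, mem_ofPred_eq] at hx hx'
  have h1 : C ∣ C' := hc.dvd_of_dvd_mul_left ⟨D', h.symm⟩
  have h2 : C' ∣ C := hc'.dvd_of_dvd_mul_right ⟨D, by rw [h, mul_comm]⟩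
  have h3 : C = C' := Int.dvd_antisymm (by omega) (by omega) h1 h2
  subst h3
  have h4 : D = D' := by
    rcases hx with h0 | ⟨rfl, hD⟩
    · have : C * D' = C * D := by rw [h, mul_comm]
      exact (mul_left_cancel₀ h0.ne' this).symm
    · have e1 : D = 1 := by
        rcases Int.isUnit_iff.1 (isCoprime_zero_left.1 hc) with h | h <;> omega
      have e2 : D' = 1 := by
        rcases Int.isUnit_iff.1 (isCoprime_zero_left.1 hc') with h | h <;> omega
      rw [e1, e2]
  subst h4
  rfl

theorem mk_primPairLift_bijective {N : ℕ} (hN : Squarefree N) : Function.Bijective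
    fun x : primPairs => (Quotient.mk'' (primPairLift hN x) : ParabolicCosets N) := by
  have hN0 : 0 < N := Nat.pos_of_ne_zero hN.ne_zero
  have hpos : ∀ c : ℕ, 0 < √((N / N.gcd c : ℕ) : ℝ) := fun c => Real.sqrt_pos.2 <| by
    exact_mod_cast Nat.div_pos (Nat.le_of_dvd hN0 (Nat.gcd_dvd_left _ _))
      (Nat.gcd_pos_of_pos_left c hN0)
  constructor
  · intro x x' h
    obtain ⟨h1, h2⟩ := (exists_moonshineGroup_of_coprime hN x.2.2).choose_spec
    obtain ⟨h1', h2'⟩ := (exists_moonshineGroup_of_coprime hN x'.2.2).choose_spec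
    have h := (mk_eq_mk_parabolicCosets_iff _ _).1 h
    simp only [primPairLift] at h
    rw [h1, h2, h1', h2'] at h
    have hne := mul_ne_zero (hpos x.1.1.natAbs).ne' (hpos x'.1.1.natAbs).ne'
    have : (x'.1.1 : ℝ) * x.1.2 = x'.1.2 * x.1.1 := by
      apply mul_left_cancel₀ hne
      linear_combination h
    exact (primPairs_ext (by exact_mod_cast this)).symm
  · intro q
    induction q using Quotient.inductionOn' with
    | h γ =>
      obtain ⟨C, D, hcop, h1, h2⟩ := exists_coprime_of_moonshineGroup hN γ
      have hor : (C, D) ∈ posPairs ∨ (-C, -D) ∈ posPairs := by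
        simp only [posPairs, mem_ofPred_eq]
        by_cases hC : C = 0
        · subst hC
          have := (isCoprime_zero_left.1 hcop).ne_zero
          omega
        · omega
      obtain ⟨x, k, hx1, hx2⟩ : ∃ (x : primPairs) (k : ℤ), x.1.1 = k * C ∧ x.1.2 = k * D := by
        rcases hor with h | h
        · exact ⟨⟨_, h, hcop⟩, 1, by simp, by simp⟩
        · exact ⟨⟨_, h, hcop.neg_neg⟩, -1, by simp, by simp⟩
      refine ⟨x, (mk_eq_mk_parabolicCosets_iff _ _).2 ?_⟩
      obtain ⟨h1', h2'⟩ := (exists_moonshineGroup_of_coprime hN x.2.2).choose_spec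
      simp only [primPairLift]
      rw [h1, h2, h1', h2', hx1, hx2]
      push_cast
      ring

theorem cosetIm_mk_primPairLift {N : ℕ} (hN : Squarefree N) (z : ℍ) (x : primPairs) :
    cosetIm N z (Quotient.mk'' (primPairLift hN x)) =
      N.gcd x.1.1.natAbs / N * (z.im / latticeNormSq z x) := by
  obtain ⟨h1, h2⟩ := (exists_moonshineGroup_of_coprime hN x.2.2).choose_spec
  change ((primPairLift hN x : SL(2, ℝ)) • z).im = _
  have him := UpperHalfPlane.im_smul_eq_div_normSq
    (((primPairLift hN x : moonshineGroup N) : SL(2, ℝ)) : GL (Fin 2) ℝ) z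
  change ((primPairLift hN x : SL(2, ℝ)) • z).im = _ at him
  rw [him]
  have hN0 : 0 < N := Nat.pos_of_ne_zero hN.ne_zero
  have hdvd := Nat.gcd_dvd_left N x.1.1.natAbs
  have hM0 := Nat.gcd_pos_of_pos_left x.1.1.natAbs hN0
  have hden : Complex.normSq (denom (((primPairLift hN x : moonshineGroup N) : SL(2, ℝ)) :
      GL (Fin 2) ℝ) z) = (N / N.gcd x.1.1.natAbs : ℕ) * latticeNormSq z x := by
    have : denom (((primPairLift hN x : moonshineGroup N) : SL(2, ℝ)) : GL (Fin 2) ℝ) z =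
        (√((N / N.gcd x.1.1.natAbs : ℕ) : ℝ) : ℂ) * (x.1.1 * z + x.1.2) := by
      have e1 : (primPairLift hN x : SL(2, ℝ)) 1 0 = _ := h1
      have e2 : (primPairLift hN x : SL(2, ℝ)) 1 1 = _ := h2
      simp [denom, e1, e2]
      ring
    rw [this, Complex.normSq_mul, Complex.normSq_ofReal, Real.mul_self_sqrt (Nat.cast_nonneg _)]
    rfl
  have hM0' : ((N.gcd x.1.1.natAbs : ℕ) : ℝ) ≠ 0 := by exact_mod_cast hM0.ne'
  rw [hden, Nat.cast_div hdvd hM0']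
  simp
  field_simp

theorem hasSum_cosetIm_cpow {N : ℕ} (hN : Squarefree N) (z : ℍ) {s : ℂ} (hs : 1 < s.re) :
    HasSum (fun γ : ParabolicCosets N => (cosetIm N z γ : ℂ) ^ s)
      ((∑ v ∈ N.divisors, levelOneEisenstein (natDilate v z) s) /
        ∑ v ∈ N.divisors, (v : ℂ) ^ s) := by
  rw [← (Equiv.ofBijective _ (mk_primPairLift_bijective hN)).hasSum_iff]
  refine (hasSum_primPairs_gcd hN z hs).congr_fun fun x => ?_
  rw [← cosetIm_mk_primPairLift hN]
  rfl

/-! ### Values at `s = 0` and the eta function -/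

theorem besselTerm_zero (w : ℝ) {Y : ℝ} (hY : 0 < Y) (k : ℕ) :
    besselTerm w Y 0 k =
      ((2 * (Real.exp (-(2 * Real.pi * Y)) ^ (k + 1) * Real.cos (2 * Real.pi * w * (k + 1)) /
        (k + 1)) : ℝ) : ℂ) := by
  have hπ := Real.sqrt_pos.2 Real.pi_pos
  have hsq := Real.sq_sqrt Real.pi_pos.le
  have ha : 0 < √Real.pi * ((k : ℝ) + 1) := by positivity
  have h := mellin_expKernel_neg_half ha (mul_pos hπ hY)
  rw [mul_pow, mul_pow, hsq] at h
  rw [besselTerm, zero_sub, ← neg_div, h]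
  have e : 2 * (√Real.pi * ((k : ℝ) + 1)) * (√Real.pi * Y) = (k + 1 : ℕ) * (2 * Real.pi * Y) := by
    push_cast
    linear_combination (2 * ((k : ℝ) + 1) * Y) * hsq
  rw [e, ← Real.exp_nat_mul, mul_neg]
  have h0 : (√Real.pi / (√Real.pi * ((k : ℝ) + 1))) = 1 / ((k : ℝ) + 1) := by field_simp
  rw [h0]
  push_cast
  ring

theorem hasSum_besselTerm_zero (w : ℝ) {Y : ℝ} (hY : 0 < Y) :
    HasSum (besselTerm w Y 0) ((2 * -Real.log
      ‖1 - Complex.exp (2 * Real.pi * Complex.I * (w + Y * Complex.I))‖ : ℝ) : ℂ) := by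
  set q := Complex.exp (2 * Real.pi * Complex.I * (w + Y * Complex.I)) with hq
  have hqe : q = (Real.exp (-(2 * Real.pi * Y)) : ℂ) *
      Complex.exp ((2 * Real.pi * w : ℝ) * Complex.I) := by
    rw [hq, Complex.ofReal_exp, ← Complex.exp_add]
    congr 1
    push_cast
    linear_combination (2 * Real.pi * Y : ℂ) * Complex.I_mul_I
  have hnorm : ‖q‖ = Real.exp (-(2 * Real.pi * Y)) := by
    rw [hqe, norm_mul, Complex.norm_exp_ofReal_mul_I, mul_one, Complex.norm_real,
      Real.norm_of_nonneg (Real.exp_pos _).le]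
  have hlt : ‖q‖ < 1 := by
    rw [hnorm, ← Real.exp_zero]
    exact Real.exp_lt_exp.2 (by have := mul_pos Real.pi_pos hY; linarith)
  have h1 := Complex.hasSum_taylorSeries_neg_log hlt
  -- The term of index `0` is `q ^ 0 / 0 = 0` by convention, so the shift loses nothing.
  rw [← hasSum_nat_add_iff' 1] at h1
  have h2 := (Complex.hasSum_re h1).mul_left 2
  have e : (-Complex.log (1 - q) - ∑ i ∈ Finset.range 1, q ^ i / (i : ℂ)).re =
      -Real.log ‖1 - q‖ := by simp [Complex.log_re]
  rw [e] at h2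
  refine (Complex.hasSum_ofReal.2 h2).congr_fun fun k => ?_
  rw [besselTerm_zero w hY]
  congr 2
  have hpow : q ^ (k + 1) = ((Real.exp (-(2 * Real.pi * Y)) ^ (k + 1) : ℝ) : ℂ) *
      Complex.exp ((2 * Real.pi * w * (k + 1) : ℝ) * Complex.I) := by
    rw [hqe, mul_pow, ← Complex.exp_nat_mul]
    push_cast
    congr 2
    ring
  have hk : (((k + 1 : ℕ) : ℝ) : ℂ) = ((k + 1 : ℕ) : ℂ) := by push_cast; rfl
  rw [hpow, ← hk, Complex.div_ofReal_re, Complex.re_ofReal_mul, Complex.exp_ofReal_mul_I_re]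
  push_cast
  rfl

theorem hasSum_log_norm_one_sub_eta_q (z : ℍ) :
    HasSum (fun m : ℕ => ((2 * -Real.log ‖1 - ModularForm.eta_q m z‖ : ℝ) : ℂ))
      (besselSum z 0) := by
  have h1 := (summable_besselTerm z 0).hasSum
  have h2 : ∀ m : ℕ, HasSum (fun k => besselTerm ((m + 1 : ℕ) * z.re) ((m + 1 : ℕ) * z.im) 0 k) _ :=
    fun m => hasSum_besselTerm_zero ((m + 1 : ℕ) * z.re)
      (mul_pos (by positivity : (0 : ℝ) < (m + 1 : ℕ)) z.im_pos)
  have h3 := h1.prod_fiberwise h2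
  rw [← besselSum] at h3
  refine h3.congr_fun fun m => ?_
  rw [ModularForm.eta_q_eq_cexp]
  congr 7
  have hz : (z : ℂ) = z.re + z.im * Complex.I := (Complex.re_add_im (z : ℂ)).symm
  rw [hz]
  push_cast
  ring

/-- Summing over `k` first gives `-2 log |1 - q^m|` for each `m ≥ 1`. The sum over `m` is then `-2`
times the logarithm of the eta product without its factor `q^{1/24}`, of absolute value `e^{-π y /
12}`. -/
theorem besselSum_zero (z : ℍ) :
    besselSum z 0 = ((-2 * (Real.log ‖ModularForm.eta z‖ + Real.pi * z.im / 12) : ℝ) : ℂ) := by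
  have h := hasSum_log_norm_one_sub_eta_q z
  have hre : HasSum (fun m : ℕ => 2 * -Real.log ‖1 - ModularForm.eta_q m z‖)
      (besselSum z 0).re := by simpa using Complex.hasSum_re h
  have him : besselSum z 0 = ((besselSum z 0).re : ℂ) :=
    h.unique (Complex.hasSum_ofReal.2 hre)
  have hlog : HasSum (fun m : ℕ => Real.log ‖1 - ModularForm.eta_q m z‖)
      (-1 / 2 * (besselSum z 0).re) :=
    (hre.mul_left (-1 / 2)).congr_fun fun m => by ring
  have hprod := Real.hasProd_of_hasSum_log
    (fun m => norm_pos_iff.2 (ModularForm.one_sub_eta_q_ne_zero m z.im_pos)) hlog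
  have hmul : Multipliable fun m : ℕ => 1 - ModularForm.eta_q m (z : ℂ) := by
    refine ModularForm.multipliable_one_sub_pow ?_
    simpa using! UpperHalfPlane.norm_qParam_lt_one 1 z
  have heta : Real.log ‖ModularForm.eta z‖ = -(Real.pi * z.im / 12) + -1 / 2 * (besselSum z 0).re := by
    rw [ModularForm.eta, norm_mul, hmul.norm_tprod, hprod.tprod_eq,
      Function.Periodic.norm_qParam, ← Real.exp_add, Real.log_exp]
    rw [UpperHalfPlane.coe_im]
    ring
  rw [him, heta]
  congr 1
  ring

theorem Complex.Gamma_neg_half : Complex.Gamma (-1 / 2) = -2 * (√Real.pi : ℂ) := by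
  have h := Complex.Gamma_add_one (-1 / 2 : ℂ) (by norm_num)
  have h2 : Complex.Gamma (1 / 2) = (√Real.pi : ℂ) := by
    rw [Complex.Gamma_one_half_eq, Real.sqrt_eq_rpow, Complex.ofReal_cpow Real.pi_pos.le]
    norm_num
  rw [show (-1 / 2 + 1 : ℂ) = 1 / 2 by norm_num, h2] at h
  linear_combination 2 * h

theorem riemannZeta_neg_one : riemannZeta (-1) = -1 / 12 := by
  have := riemannZeta_neg_nat_eq_bernoulli 1
  norm_num [bernoulli_two] at this
  rw [this]
  norm_num

/-- The Gamma term equals `Γ(-1/2) √π y ζ(-1) = π y / 6`, which cancels the contribution of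
`q^{1/24}`. -/
theorem eisensteinTail_zero (z : ℍ) :
    eisensteinTail z 0 = ((-2 * Real.log ‖ModularForm.eta z‖ : ℝ) : ℂ) := by
  have hπ := Real.pi_pos
  have e : ((Real.pi * z.im ^ 2 : ℝ) : ℂ) ^ (1 / 2 - 0 : ℂ) = ((√Real.pi * z.im : ℝ) : ℂ) := by
    have := z.im_pos
    rw [show (1 / 2 - 0 : ℂ) = ((1 / 2 : ℝ) : ℂ) by push_cast; ring,
      ← Complex.ofReal_cpow (by positivity), ← Real.sqrt_eq_rpow, Real.sqrt_mul hπ.le,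
      Real.sqrt_sq this.le]
  have hsq : (√Real.pi : ℂ) * √Real.pi = Real.pi := by
    exact_mod_cast Real.mul_self_sqrt hπ.le
  rw [eisensteinTail, e, besselSum_zero, show (0 - 1 / 2 : ℂ) = -1 / 2 by ring,
    show (2 * 0 - 1 : ℂ) = -1 by ring, Complex.Gamma_neg_half, riemannZeta_neg_one,
    Complex.cpow_zero]
  push_cast
  linear_combination (z.im / 6 : ℂ) * hsq

/-! ### The level one series near `s = 0` -/

theorem differentiableAt_eisensteinTail (z : ℍ) {s : ℂ} (h1 : ∀ m : ℕ, s - 1 / 2 ≠ -m)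
    (h2 : 2 * s - 1 ≠ 1) : DifferentiableAt ℂ (eisensteinTail z) s := by
  have hπ : (Real.pi : ℂ) ≠ 0 := by exact_mod_cast Real.pi_ne_zero
  have hB : ((Real.pi * z.im ^ 2 : ℝ) : ℂ) ≠ 0 := by
    have := z.im_pos
    have := Real.pi_pos
    exact_mod_cast (by positivity : (0 : ℝ) < Real.pi * z.im ^ 2).ne'
  have d1 : DifferentiableAt ℂ (fun s : ℂ => Complex.Gamma (s - 1 / 2)) s :=
    (Complex.differentiableAt_Gamma _ h1).comp s (by fun_prop)
  have d2 : DifferentiableAt ℂ (fun s : ℂ => riemannZeta (2 * s - 1)) s :=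
    (differentiableAt_riemannZeta h2).comp s (by fun_prop)
  have d3 : DifferentiableAt ℂ
      (fun s : ℂ => ((Real.pi * z.im ^ 2 : ℝ) : ℂ) ^ (1 / 2 - s)) s :=
    DifferentiableAt.const_cpow (by fun_prop) (Or.inl hB)
  have d4 : DifferentiableAt ℂ (fun s : ℂ => (Real.pi : ℂ) ^ s) s :=
    DifferentiableAt.const_cpow (by fun_prop) (Or.inl hπ)
  exact d4.mul (((d1.mul d3).mul d2).add (differentiable_besselSum z s))

/-- Writing `1 / Γ(s) = s / Γ(s + 1)` makes the zero at `s = 0` explicit; the identity holds there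
too. -/
theorem levelOneEisenstein_eq (z : ℍ) (s : ℂ) : levelOneEisenstein z s = (z.im : ℂ) ^ s *
    (1 + s * (eisensteinTail z s * (Complex.Gamma (s + 1))⁻¹ * (riemannZeta (2 * s))⁻¹)) := by
  rw [levelOneEisenstein, div_eq_mul_inv, mul_inv,
    Complex.one_div_Gamma_eq_self_mul_one_div_Gamma_add_one]
  ring

theorem differentiableAt_levelOneEisenstein (z : ℍ) {s : ℂ} (h1 : ∀ m : ℕ, s - 1 / 2 ≠ -m)
    (h2 : 2 * s - 1 ≠ 1) (h3 : 2 * s ≠ 1) (h4 : riemannZeta (2 * s) ≠ 0) :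
    DifferentiableAt ℂ (levelOneEisenstein z) s := by
  have hy : (z.im : ℂ) ≠ 0 := by exact_mod_cast z.im_pos.ne'
  have d1 : DifferentiableAt ℂ (fun s : ℂ => (z.im : ℂ) ^ s) s :=
    DifferentiableAt.const_cpow (by fun_prop) (Or.inl hy)
  have d2 : DifferentiableAt ℂ (fun s : ℂ => (Complex.Gamma (s + 1))⁻¹) s :=
    (Complex.differentiable_one_div_Gamma (s + 1)).comp s
      (f := fun s : ℂ => s + 1) (by fun_prop)
  have d3 : DifferentiableAt ℂ (fun s : ℂ => riemannZeta (2 * s)) s :=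
    (differentiableAt_riemannZeta h3).comp s (by fun_prop)
  have d4 := ((differentiableAt_eisensteinTail z h1 h2).fun_mul d2).fun_mul (d3.fun_inv h4)
  rw [funext (levelOneEisenstein_eq z)]
  exact d1.mul ((differentiableAt_const 1).add (differentiableAt_id.mul d4))

theorem eventually_differentiableAt_levelOneEisenstein (z : ℍ) :
    ∀ᶠ s in 𝓝 (0 : ℂ), DifferentiableAt ℂ (levelOneEisenstein z) s := by
  have hζ : ∀ᶠ s in 𝓝 (0 : ℂ), riemannZeta (2 * s) ≠ 0 := by
    have hc : ContinuousAt (fun s : ℂ => riemannZeta (2 * s)) 0 :=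
      ContinuousAt.comp (g := riemannZeta) (f := fun s : ℂ => 2 * s)
        (differentiableAt_riemannZeta (by simp)).continuousAt (by fun_prop)
    refine hc.eventually_ne ?_
    rw [mul_zero, riemannZeta_zero]
    norm_num
  -- The radius `1/4` keeps `s` away from the poles of `Γ(s - 1/2)`, `ζ(2s)` and `ζ(2s - 1)`, the
  -- nearest of which lie at `s = ±1/2`.
  have hball := Metric.ball_mem_nhds (0 : ℂ) (show (0 : ℝ) < 1 / 4 by norm_num)
  filter_upwards [hζ, hball] with s hs hb
  have hre : |s.re| < 1 / 4 := (Complex.abs_re_le_norm s).trans_lt (by simpa using hb)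
  rw [abs_lt] at hre
  refine differentiableAt_levelOneEisenstein z (fun m h => ?_) (fun h => ?_) (fun h => ?_) hs
  · have h := congrArg Complex.re h
    simp at h
    rcases m with _ | m
    · norm_num at h; linarith
    · push_cast at h
      have : (0 : ℝ) ≤ m := Nat.cast_nonneg m
      linarith
  · have h := congrArg Complex.re h
    simp at h
    linarith
  · have h := congrArg Complex.re h
    simp at h
    linarith

theorem levelOneEisenstein_zero (z : ℍ) : levelOneEisenstein z 0 = 1 := by
  simp [levelOneEisenstein_eq]

theorem hasDerivAt_levelOneEisenstein_zero (z : ℍ) :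
    HasDerivAt (levelOneEisenstein z)
      ((Real.log z.im + 4 * Real.log ‖ModularForm.eta z‖ : ℝ) : ℂ) 0 := by
  have hy : (z.im : ℂ) ≠ 0 := by exact_mod_cast z.im_pos.ne'
  have d1 : HasDerivAt (fun s : ℂ => (z.im : ℂ) ^ s) _ 0 :=
    (hasDerivAt_id (0 : ℂ)).const_cpow (Or.inl hy)
  have c2 : DifferentiableAt ℂ (fun s : ℂ => (Complex.Gamma (s + 1))⁻¹) 0 :=
    (Complex.differentiable_one_div_Gamma (0 + 1)).comp 0
      (f := fun s : ℂ => s + 1) (by fun_prop)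
  have hζ0 : riemannZeta (2 * 0) ≠ 0 := by rw [mul_zero, riemannZeta_zero]; norm_num
  have c3 : DifferentiableAt ℂ (fun s : ℂ => riemannZeta (2 * s)) 0 :=
    (differentiableAt_riemannZeta (by simp : (2 * 0 : ℂ) ≠ 1)).comp 0 (by fun_prop)
  have c1 : DifferentiableAt ℂ (eisensteinTail z) 0 := by
    refine differentiableAt_eisensteinTail z (fun m h => ?_) (by norm_num)
    have h := congrArg Complex.re h
    simp at h
    have h' : (2 * m : ℝ) = 1 := by linarith
    have : 2 * m = 1 := by exact_mod_cast h'
    omega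
  have d4 := ((c1.fun_mul c2).fun_mul (c3.fun_inv hζ0)).hasDerivAt
  have d5 := d1.mul (((hasDerivAt_id (0 : ℂ)).mul d4).const_add 1)
  rw [funext (levelOneEisenstein_eq z)]
  convert! d5 using 1
  -- Only the value at `0` of the cofactor of `s` survives: `-2 log |η| / ζ(0) = 4 log |η|`.
  simp only [id_eq, mul_zero, zero_add, Complex.Gamma_one, riemannZeta_zero, Complex.cpow_zero,
    eisensteinTail_zero]
  push_cast
  rw [Complex.ofReal_log z.im_pos.le]
  norm_num
  ring

/-! ### Meromorphic continuation -/

/-- At `s = 1` the function `(s - 1) ζ(s)` has a removable singularity with value `1`. -/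
theorem meromorphic_riemannZeta : Meromorphic riemannZeta := by
  intro s
  rcases eq_or_ne s 1 with rfl | hs
  · set g : ℂ → ℂ := Function.update (fun s => (s - 1) * riemannZeta s) 1 1 with hg
    have hgne : ∀ s ≠ 1, g s = (s - 1) * riemannZeta s := fun s hs =>
      Function.update_of_ne hs _ _
    have hga : AnalyticAt ℂ g 1 := by
      refine Complex.analyticAt_of_differentiable_on_punctured_nhds_of_continuousAt ?_ ?_
      · filter_upwards [self_mem_nhdsWithin] with s (hs : s ≠ 1)
        refine DifferentiableAt.congr_of_eventuallyEq
          (f := fun s => (s - 1) * riemannZeta s)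
          (DifferentiableAt.mul (by fun_prop) (differentiableAt_riemannZeta hs)) ?_
        filter_upwards [isOpen_ne.mem_nhds hs] with t ht using hgne t ht
      · exact continuousAt_update_same.2 riemannZeta_residue_one
    have hm : MeromorphicAt (fun s => g s / (s - 1)) 1 :=
      hga.meromorphicAt.div (by fun_prop : AnalyticAt ℂ (fun s : ℂ => s - 1) 1).meromorphicAt
    refine hm.congr ?_
    filter_upwards [self_mem_nhdsWithin] with s (hs : s ≠ 1)
    rw [hgne s hs, mul_div_cancel_left₀ _ (sub_ne_zero.2 hs)]
  · refine (Complex.analyticAt_iff_eventually_differentiableAt.2 ?_).meromorphicAt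
    filter_upwards [isOpen_ne.mem_nhds hs] with t ht using differentiableAt_riemannZeta ht

theorem meromorphicAt_levelOneEisenstein (z : ℍ) (s : ℂ) :
    MeromorphicAt (levelOneEisenstein z) s := by
  have hπ : (Real.pi : ℂ) ≠ 0 := by exact_mod_cast Real.pi_ne_zero
  have hy : (z.im : ℂ) ≠ 0 := by exact_mod_cast z.im_pos.ne'
  have hB : ((Real.pi * z.im ^ 2 : ℝ) : ℂ) ≠ 0 := by
    have := z.im_pos
    have := Real.pi_pos
    exact_mod_cast (by positivity : (0 : ℝ) < Real.pi * z.im ^ 2).ne'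
  have entire : ∀ f : ℂ → ℂ, Differentiable ℂ f → MeromorphicAt f s :=
    fun f hf => (hf.analyticAt s).meromorphicAt
  have m1 : MeromorphicAt (fun s : ℂ => Complex.Gamma (s - 1 / 2)) s :=
    (Meromorphic.Gamma (s - 1 / 2)).comp_analyticAt (g := fun s : ℂ => s - 1 / 2) (by fun_prop)
  have m2 : MeromorphicAt (fun s : ℂ => riemannZeta (2 * s - 1)) s :=
    (meromorphic_riemannZeta (2 * s - 1)).comp_analyticAt (g := fun s : ℂ => 2 * s - 1)
      (by fun_prop)
  have m3 : MeromorphicAt (fun s : ℂ => riemannZeta (2 * s)) s :=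
    (meromorphic_riemannZeta (2 * s)).comp_analyticAt (g := fun s : ℂ => 2 * s) (by fun_prop)
  have m4 := entire (fun s => ((Real.pi * z.im ^ 2 : ℝ) : ℂ) ^ (1 / 2 - s)) fun s =>
    DifferentiableAt.const_cpow (by fun_prop) (Or.inl hB)
  have m5 := entire (fun s => (Real.pi : ℂ) ^ s) fun s =>
    DifferentiableAt.const_cpow (by fun_prop) (Or.inl hπ)
  have m6 := entire (fun s => (z.im : ℂ) ^ s) fun s =>
    DifferentiableAt.const_cpow (by fun_prop) (Or.inl hy)
  have m7 := entire _ (differentiable_besselSum z)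
  exact m6.mul ((MeromorphicAt.const 1 s).add
    ((m5.mul (((m1.mul m4).mul m2).add m7)).div ((Meromorphic.Gamma s).mul m3)))

/-- The meromorphic function continuing the Eisenstein series of `Γ₀(N)⁺` at the cusp `i∞`. -/
noncomputable def moonshineEisenstein (N : ℕ) (z : ℍ) (s : ℂ) : ℂ :=
  (∑ v ∈ N.divisors, levelOneEisenstein (natDilate v z) s) / ∑ v ∈ N.divisors, (v : ℂ) ^ s

theorem differentiable_sum_divisors_cpow (N : ℕ) :
    Differentiable ℂ fun s : ℂ => ∑ v ∈ N.divisors, (v : ℂ) ^ s := fun s =>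
  DifferentiableAt.fun_sum fun v hv => DifferentiableAt.const_cpow differentiableAt_id
    (Or.inl (by exact_mod_cast (Nat.pos_of_mem_divisors hv).ne'))

theorem meromorphicAt_moonshineEisenstein (N : ℕ) (z : ℍ) (s : ℂ) :
    MeromorphicAt (moonshineEisenstein N z) s :=
  (MeromorphicAt.fun_sum fun v _ => meromorphicAt_levelOneEisenstein (natDilate v z) s).div
    ((differentiable_sum_divisors_cpow N).analyticAt s).meromorphicAt

theorem analyticAt_moonshineEisenstein {N : ℕ} (hN : Squarefree N) (z : ℍ) {s : ℂ}
    (hs : 1 < s.re) : AnalyticAt ℂ (moonshineEisenstein N z) s := by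
  refine Complex.analyticAt_iff_eventually_differentiableAt.2 ?_
  filter_upwards [(isOpen_lt continuous_const Complex.continuous_re).mem_nhds hs]
    with t (ht : 1 < t.re)
  have hne : ∀ {a : ℂ}, a.re ≠ 0 → a ≠ 0 := fun h h0 => h (by simp [h0])
  refine DifferentiableAt.fun_div (DifferentiableAt.fun_sum fun v _ =>
    differentiableAt_levelOneEisenstein _ (fun m h => ?_) (fun h => ?_) (fun h => ?_)
      (riemannZeta_ne_zero_of_one_le_re (by simp; linarith)))
    (differentiable_sum_divisors_cpow N t) (sum_divisors_cpow_ne_zero hN (by linarith))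
  · have h := congrArg Complex.re h
    simp at h
    have : (0 : ℝ) ≤ m := Nat.cast_nonneg m
    linarith
  · have h := congrArg Complex.re h
    simp at h
    linarith
  · have h := congrArg Complex.re h
    simp at h
    linarith

/-! ### Taylor expansion at `s = 0` for level `N` -/

theorem Nat.card_divisors_of_squarefree {N : ℕ} (hN : Squarefree N) :
    N.divisors.card = 2 ^ N.primeFactors.card := by
  rw [Nat.card_divisors hN.ne_zero, ← Finset.prod_const]
  refine Finset.prod_congr rfl fun p hp => ?_
  rw [Nat.factorization_eq_one_of_squarefree hN (Nat.prime_of_mem_primeFactors hp)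
    (Nat.dvd_of_mem_primeFactors hp)]

theorem analyticAt_moonshineEisenstein_zero {N : ℕ} (hN : Squarefree N) (z : ℍ) :
    AnalyticAt ℂ (moonshineEisenstein N z) 0 := by
  have hcard : (N.divisors.card : ℂ) ≠ 0 := by
    rw [Nat.card_divisors_of_squarefree hN]
    simp
  have h1 : ∀ v ∈ N.divisors, AnalyticAt ℂ (levelOneEisenstein (natDilate v z)) 0 := fun v _ =>
    Complex.analyticAt_iff_eventually_differentiableAt.2
      (eventually_differentiableAt_levelOneEisenstein _)
  refine AnalyticAt.fun_div (Finset.analyticAt_fun_sum _ h1)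
    ((differentiable_sum_divisors_cpow N).analyticAt 0) ?_
  simpa using hcard

theorem moonshineEisenstein_zero {N : ℕ} (hN : Squarefree N) (z : ℍ) :
    moonshineEisenstein N z 0 = 1 := by
  have hcard : (N.divisors.card : ℂ) ≠ 0 := by
    rw [Nat.card_divisors_of_squarefree hN]
    simp
  simp only [moonshineEisenstein, levelOneEisenstein_zero, Complex.cpow_zero, Finset.sum_const,
    nsmul_eq_mul, mul_one]
  exact div_self hcard

theorem log_prod_norm_eta {N : ℕ} (hN : Squarefree N) (z : ℍ) :
    Real.log ((∏ v ∈ N.divisors, ‖ModularForm.eta ((v : ℂ) * (z : ℂ))‖ ^ 4) ^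
        ((1 : ℝ) / 2 ^ N.primeFactors.card) * z.im) =
      (∑ v ∈ N.divisors, 4 * Real.log ‖ModularForm.eta (natDilate v z)‖) / N.divisors.card +
        Real.log z.im := by
  have hpos : ∀ v ∈ N.divisors, 0 < ‖ModularForm.eta ((v : ℂ) * (z : ℂ))‖ ^ 4 := fun v hv => by
    rw [← coe_natDilate (Nat.pos_of_mem_divisors hv)]
    exact pow_pos (norm_pos_iff.2 (ModularForm.eta_ne_zero (natDilate v z).im_pos)) 4
  have hprod := Finset.prod_pos hpos
  rw [Real.log_mul (Real.rpow_pos_of_pos hprod _).ne' z.im_pos.ne', Real.log_rpow hprod,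
    Real.log_prod fun v hv => (hpos v hv).ne', Nat.card_divisors_of_squarefree hN]
  congr 1
  rw [one_div, inv_mul_eq_div]
  push_cast
  congr 1
  refine Finset.sum_congr rfl fun v hv => ?_
  rw [coe_natDilate (Nat.pos_of_mem_divisors hv), Real.log_pow]
  push_cast
  rfl

/-- Numerator and denominator both equal `2^r` at `0`, so the derivative is the difference of theirs
divided by `2^r`; the `log v` in `log (v y)` cancel. -/
theorem hasDerivAt_moonshineEisenstein_zero {N : ℕ} (hN : Squarefree N) (z : ℍ) :
    HasDerivAt (moonshineEisenstein N z)
      (Real.log ((∏ v ∈ N.divisors, ‖ModularForm.eta ((v : ℂ) * (z : ℂ))‖ ^ 4) ^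
        ((1 : ℝ) / 2 ^ N.primeFactors.card) * z.im) : ℂ) 0 := by
  have hcard : (N.divisors.card : ℂ) ≠ 0 := by
    rw [Nat.card_divisors_of_squarefree hN]
    simp
  have h1 := HasDerivAt.fun_sum (u := N.divisors) fun v _ =>
    hasDerivAt_levelOneEisenstein_zero (natDilate v z)
  have h2 : HasDerivAt (fun s : ℂ => ∑ v ∈ N.divisors, (v : ℂ) ^ s)
      (∑ v ∈ N.divisors, ((Real.log v : ℝ) : ℂ)) 0 := by
    refine HasDerivAt.fun_sum fun v hv => ?_
    have hv : (v : ℂ) ≠ 0 := by exact_mod_cast (Nat.pos_of_mem_divisors hv).ne'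
    convert! (hasDerivAt_id (0 : ℂ)).const_cpow (Or.inl hv) using 1
    simp [Complex.natCast_log]
  have h3 := h1.fun_div h2 (by simpa using hcard)
  convert! h3 using 1
  simp only [levelOneEisenstein_zero, Complex.cpow_zero, Finset.sum_const, nsmul_eq_mul, mul_one]
  have hsum : ∑ v ∈ N.divisors, Real.log (natDilate v z).im =
      ∑ v ∈ N.divisors, Real.log v + N.divisors.card * Real.log z.im := by
    rw [← nsmul_eq_mul, ← Finset.sum_const, ← Finset.sum_add_distrib]
    refine Finset.sum_congr rfl fun v hv => ?_
    have hv0 := Nat.pos_of_mem_divisors hv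
    rw [natDilate_im hv0, Real.log_mul (by exact_mod_cast hv0.ne') z.im_pos.ne']
  rw [log_prod_norm_eta hN, ← Complex.ofReal_sum, ← Complex.ofReal_sum, Finset.sum_add_distrib,
    hsum]
  push_cast
  field_simp
  ring

/-! ### Taylor remainder, uniqueness in normal form, and conclusion -/

theorem isBigO_taylor_two {f : ℂ → ℂ} (hf : AnalyticAt ℂ f 0) {c : ℂ} (hc : HasDerivAt f c 0) :
    (fun s => f s - (f 0 + c * s)) =O[𝓝 0] fun s => s ^ 2 := by
  obtain ⟨p, hp⟩ := hf
  have h := hp.isBigO_sub_partialSum_pow 2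
  have h' := h.norm_right
  simp only [zero_add, ← norm_pow, norm_norm] at h'
  have h2 := h'.of_norm_right
  refine h2.congr_left fun s => ?_
  have e0 : p.coeff 0 = f 0 := hp.coeff_zero _
  have e1 : p.coeff 1 = c := hp.hasDerivAt.unique hc
  simp [FormalMultilinearSeries.partialSum, Finset.sum_range_succ, e0, e1, mul_comm]

/-- Infinite order of vanishing of `f - g` spreads over the connected plane, giving agreement on
punctured neighbourhoods; normal form extends it to the centre, poles included. -/
theorem MeromorphicNFOn.eq_of_eventuallyEq {f g : ℂ → ℂ} (hf : MeromorphicNFOn f univ)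
    (hg : MeromorphicNFOn g univ) {a : ℂ} (h : f =ᶠ[𝓝 a] g) : f = g := by
  have hm : MeromorphicOn (f - g) univ := hf.meromorphicOn.sub hg.meromorphicOn
  have htop : meromorphicOrderAt (f - g) a = ⊤ := by
    rw [meromorphicOrderAt_eq_top_iff]
    filter_upwards [h.filter_mono nhdsWithin_le_nhds] with s hs
    rw [Pi.sub_apply, hs, sub_self]
  funext x
  have hx : meromorphicOrderAt (f - g) x = ⊤ := by
    by_contra hne
    exact hm.meromorphicOrderAt_ne_top_of_isPreconnected isPreconnected_univ (mem_univ x)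
      (mem_univ a) hne htop
  rw [meromorphicOrderAt_eq_top_iff] at hx
  have he : f =ᶠ[𝓝[≠] x] g := by
    filter_upwards [hx] with s hs using sub_eq_zero.1 hs
  exact (((hf (mem_univ x)).eventuallyEq_nhdsNE_iff_eventuallyEq_nhds (hg (mem_univ x))).1
    he).eq_of_nhds

theorem toMeromorphicNFOn_eventuallyEq_of_analyticAt {f : ℂ → ℂ} (hf : MeromorphicOn f univ)
    {x : ℂ} (hx : AnalyticAt ℂ f x) : toMeromorphicNFOn f univ =ᶠ[𝓝 x] f := by
  have h := toMeromorphicNFOn_eq_toMeromorphicNFAt_on_nhds hf (mem_univ x)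
  rwa [toMeromorphicNFAt_eq_self.2 hx.meromorphicNFAt] at h

theorem isRealAnalyticEisenstein_toMeromorphicNFOn {N : ℕ} (hN : Squarefree N) (z : ℍ) :
    IsRealAnalyticEisenstein N z (toMeromorphicNFOn (moonshineEisenstein N z) univ) where
  meromorphic := meromorphicNFOn_toMeromorphicNFOn _ _
  hasSum s hs := by
    rw [(toMeromorphicNFOn_eventuallyEq_of_analyticAt
      (fun x _ => meromorphicAt_moonshineEisenstein N z x)
      (analyticAt_moonshineEisenstein hN z hs)).eq_of_nhds]
    exact hasSum_cosetIm_cpow hN z hs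

theorem IsRealAnalyticEisenstein.unique {N : ℕ} {z : ℍ} {E E' : ℂ → ℂ}
    (h : IsRealAnalyticEisenstein N z E) (h' : IsRealAnalyticEisenstein N z E') : E = E' := by
  refine h.meromorphic.eq_of_eventuallyEq h'.meromorphic (a := 2) ?_
  filter_upwards [(isOpen_lt continuous_const Complex.continuous_re).mem_nhds
    (show (1 : ℝ) < (2 : ℂ).re by norm_num)] with s hs
  exact (h.hasSum s hs).unique (h'.hasSum s hs)

theorem proposition5p3 (N : ℕ) (hN : Squarefree N) (z : UpperHalfPlane) :
    (∃! E : ℂ → ℂ, IsRealAnalyticEisenstein N z E) ∧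
    ∀ E : ℂ → ℂ, IsRealAnalyticEisenstein N z E →
      AnalyticAt ℂ E 0 ∧
      (fun s : ℂ => E s - (1 + (Real.log
        ((∏ v ∈ N.divisors, ‖ModularForm.eta ((v : ℂ) * (z : ℂ))‖ ^ 4) ^
          ((1 : ℝ) / 2 ^ N.primeFactors.card) * z.im) : ℂ) * s))
        =O[𝓝 0] (fun s : ℂ => s ^ 2) := by
  have h0 := isRealAnalyticEisenstein_toMeromorphicNFOn hN z
  refine ⟨⟨_, h0, fun E hE => hE.unique h0⟩, fun E hE => ?_⟩
  have hev : E =ᶠ[𝓝 0] moonshineEisenstein N z := by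
    rw [hE.unique h0]
    exact toMeromorphicNFOn_eventuallyEq_of_analyticAt
      (fun x _ => meromorphicAt_moonshineEisenstein N z x)
      (analyticAt_moonshineEisenstein_zero hN z)
  have han := (analyticAt_moonshineEisenstein_zero hN z).congr hev.symm
  refine ⟨han, ?_⟩
  have h := isBigO_taylor_two han
    ((hasDerivAt_moonshineEisenstein_zero hN z).congr_of_eventuallyEq hev)
  rwa [hev.eq_of_nhds, moonshineEisenstein_zero hN] at h
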